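/- **Setting.** Let $(\mathcal Q,\le)$ be a quasi-ordered set (for instance a better-quasi-order). For $A,B\colon\omega^\omega\to\mathcal Q$ write $A\le_w B$ ("$A$ is Wadge reducible to $B$") if there is a continuous $\theta\colon\omega^\omega\to\omega^\omega$ with $A(X)\le B(\theta(X))$ for all $X$. The $\mathbf\Sigma^0_1$ sets are the open sets, and for $\xi>1$ a set is $\mathbf\Sigma^0_\xi$ if it is a countable union of sets that are complements of $\mathbf\Sigma^0_\beta$ sets with $1\le\beta<\xi$; a function is $\mathbf\Sigma^0_\xi$-measurable if preimages of open sets are $\mathbf\Sigma^0_\xi$. **Terms.** For a set $R$ of terms (playing the role of constants) and a countable ordinal $\alpha$, the sets ${\rm Tree}^{\omega^\alpha}(R)$ are defined inductively: $R\subseteq{\rm Tree}^{\omega^0}(R)$; ${\rm Tree}^{\omega^\beta}(R)\subseteq{\rm Tree}^{\omega^\alpha}(R)$ for $\beta\le\alpha$; if $\beta<\alpha$ and $T\in{\rm Tree}^{\omega^\alpha}(R)$ then $\langle T\rangle^{\omega^\beta}\in{\rm Tree}^{\omega^\alpha}(R)$; if $T,F_0,F_1,\dots\in{\rm Tree}^{\omega^\alpha}(R)$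 and $T$ is a constant $q\in\mathcal Q$ or a term of the form $\langle S\rangle^{\omega^\gamma}$, then $T{}^\to\bigsqcup_iF_i\in{\rm Tree}^{\omega^\alpha}(R)$. Put ${\rm Tree}^0(\mathcal Q)=\mathcal Q$. For a countable ordinal $\xi>0$ write $\xi=\omega^\alpha+\beta$ with $\beta<\omega^{\alpha+1}$, and let ${\rm Tree}^\xi(\mathcal Q)={\rm Tree}^{\omega^\alpha}(\mathcal Q)$ if $\beta=0$ and ${\rm Tree}^\xi(\mathcal Q)={\rm Tree}^{\omega^\alpha}(\{\langle T\rangle^{\omega^\alpha}:T\in{\rm Tree}^\beta(\mathcal Q)\})$ if $\beta>0$. Finally ${}^\sqcup{\rm Tree}^\xi(\mathcal Q)$ consists of the terms $T\in{\rm Tree}^\xi(\mathcal Q)$ and of the terms $\bigsqcup_{i\in\omega}F_i$ with all $F_i\in{\rm Tree}^\xi(\mathcal Q)$. **Pointclasses.** A function on a nonempty closed or open subset $P$ of $\omega^\omega$ is identified with a function on $\omega^\omega$, by composing it with a continuous retraction $\omega^\omega\to P$ if $P$ is closed, and with a homeomorphism $\omega^\omega\to P$ if $P$ is open; the function with empty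 domain belongs to every class. The class $\Sigma_T$ of functions $\omega^\omega\to\mathcal Q$ is defined by induction on $T$: $\Sigma_q$ consists of the constant function $q$; $A\in\Sigma_{\bigsqcup_iF_i}$ iff there is a partition of $\omega^\omega$ into (possibly empty) clopen sets $(C_i)_{i\in\omega}$ with $A\restriction C_i\in\Sigma_{F_i}$ for all $i$; $A\in\Sigma_{T^\to S}$ iff there is an open $V\subseteq\omega^\omega$ with $A\restriction(\omega^\omega\setminus V)\in\Sigma_T$ and $A\restriction V\in\Sigma_S$; and $A\in\Sigma_{\langle T\rangle^{\omega^\alpha}}$ iff $A=B\circ D$ for some $B\in\Sigma_T$ and some $\mathbf\Sigma^0_{1+\omega^\alpha}$-measurable $D\colon\omega^\omega\to\omega^\omega$. A function $A$ is *$\Sigma_T$-complete* if $A\in\Sigma_T$ and $B\le_wA$ for all $B\in\Sigma_T$. **Universal functions.** Let $\hat\omega=\omega\cup\{{\sf pass}\}$ be discrete, and for $X\in\hat\omega^\omega$ let $X^{\sf p}\in\omega^{\le\omega}$ be $X$ with all ${\sf pass}$es removed. A function $G\colon\hat\omega^\omega\to\hat\omega^\omega$ is *conciliatory* if $X^{\sf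 p}=Y^{\sf p}$ implies $G(X)^{\sf p}=G(Y)^{\sf p}$. It is *initializable* if for every finite string $\tau$ over $\hat\omega$ there is a continuous $\theta\colon\hat\omega^\omega\to\hat\omega^\omega$, all of whose values extend $\tau$, with $G(X)^{\sf p}=G(\theta(X))^{\sf p}$ for all $X$. A function $U\colon\hat\omega^\omega\to\hat\omega^\omega$ is *$\mathbf\Sigma^0_\xi$-universal* if it is $\mathbf\Sigma^0_\xi$-measurable and for every $\mathbf\Sigma^0_\xi$-measurable conciliatory $G$ there is a continuous $\theta\colon\hat\omega^\omega\to\hat\omega^\omega$ with $G(X)^{\sf p}=U(\theta(X))^{\sf p}$ for all $X$. **The functions $\Omega_T$.** For $A\colon\hat\omega^\omega\to\mathcal Q$ and $B\colon\omega\times\hat\omega^\omega\to\mathcal Q$ let $A{}^\to B\colon\hat\omega^\omega\to\mathcal Q$ be the following function. If $X$ has an odd entry and $X(\ell)$ is the first one, then $(A{}^\to B)(X)=B\big(\tfrac{X(\ell)-1}2,X(\ell+1),X(\ell+2),\dots\big)$; otherwise $(A{}^\to B)(X)=A(Y)$, where $Y$ is obtained from $X$ by halving all entries other than ${\sf pass}$.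 Given functions $\mathcal U_\alpha\colon\hat\omega^\omega\to\hat\omega^\omega$ for $\alpha<\omega_1$, define $\Omega_T$ by induction on $T$: $\Omega_q\colon\hat\omega^\omega\to\mathcal Q$ is constant with value $q$; $\Omega_{\bigsqcup_iF_i}\colon\omega\times\hat\omega^\omega\to\mathcal Q$ maps $(i,X)$ to $\Omega_{F_i}(X)$; $\Omega_{T^\to S}=\Omega_T{}^\to\Omega_S$; and $\Omega_{\langle T\rangle^{\omega^\alpha}}=\Omega_T\circ\mathcal U_\alpha$. View $\Omega_T$ as a function on $\omega^\omega$ through the homeomorphisms $\omega^\omega\cong\hat\omega^\omega$ and $\omega^\omega\cong\omega\times\hat\omega^\omega$ induced by the bijection $\omega\to\hat\omega$, $0\mapsto{\sf pass}$, $n+1\mapsto n$. **Proposition.** There is a family $(\mathcal U_\alpha)_{\alpha<\omega_1}$ such that each $\mathcal U_\alpha$ is a $\mathbf\Sigma^0_{1+\omega^\alpha}$-universal initializable conciliatory function. For every such family, every countable ordinal $\xi$ and every $T\in{}^\sqcup{\rm Tree}^\xi(\mathcal Q)$, the function $\Omega_T$ is $\Sigma_T$-complete. -/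

import Mathlib

open scoped Ordinal

namespace Wadge

universe u

/-! ### The finite and transfinite Borel hierarchy, Wadge reducibility -/

/-- `IsSigma0 ξ S`: the set `S` is (boldface) `Σ⁰_ξ`, for `ξ ≥ 1` (no set satisfies `IsSigma0 0`).
The `Σ⁰_1` sets are the open sets; for larger `ξ` a set is `Σ⁰_ξ` if it is a countable union of
sets each of which is `Π⁰_β` (i.e. has a `Σ⁰_β` complement) for some `β < ξ`. It is used only for
the spaces `ω^ω` and `ω̂^ω`. -/
inductive IsSigma0 {X : Type u} [TopologicalSpace X] : Ordinal.{0} → Set X → Prop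
  | of_isOpen {S : Set X} (hS : IsOpen S) : IsSigma0 1 S
  | iUnion_compl {ξ : Ordinal.{0}} (β : ℕ → Ordinal.{0}) (S : ℕ → Set X)
      (hβ : ∀ n, β n < ξ) (hS : ∀ n, IsSigma0 (β n) (S n)ᶜ) : IsSigma0 ξ (⋃ n, S n)

/-- `f` is `Σ⁰_ξ`-measurable: preimages of open sets are `Σ⁰_ξ`. -/
def Sigma0Measurable {X Y : Type*} [TopologicalSpace X] [TopologicalSpace Y]
    (ξ : Ordinal.{0}) (f : X → Y) : Prop :=
  ∀ V : Set Y, IsOpen V → IsSigma0 ξ (f ⁻¹' V)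

/-- `𝒬`-Wadge reducibility of `𝒬`-valued functions on `ω^ω`. -/
def WadgeLE {Q : Type u} [Preorder Q] (A B : (ℕ → ℕ) → Q) : Prop :=
  ∃ θ : (ℕ → ℕ) → (ℕ → ℕ), Continuous θ ∧ ∀ X, A X ≤ B (θ X)

/-- `A` is complete for the class `Γ` of `𝒬`-valued functions on `ω^ω`. -/
def IsComplete {Q : Type u} [Preorder Q] (Γ : Set ((ℕ → ℕ) → Q)) (A : (ℕ → ℕ) → Q) : Prop :=
  A ∈ Γ ∧ ∀ B ∈ Γ, WadgeLE B A

/-! ### The space `ω̂^ω` and conciliatory functions -/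

/-- `ω̂ = ω ∪ {pass}`. -/
inductive Hat : Type
  | pass : Hat
  | num (n : ℕ) : Hat

instance : TopologicalSpace Hat := ⊥

instance : DiscreteTopology Hat := ⟨rfl⟩

/-- Is the symbol a natural number (and not `pass`)? -/
def Hat.isNum : Hat → Bool
  | .pass => false
  | .num _ => true

/-- The natural number carried by a symbol (`0` for `pass`). -/
def Hat.val : Hat → ℕ
  | .pass => 0
  | .num n => n

/-- Halving a symbol; `pass` stays `pass`. -/
def Hat.half : Hat → Hat
  | .pass => .pass
  | .num n => .num (n / 2)

/-- The bijection `ω → ω̂` with `0 ↦ pass`, `n + 1 ↦ n`. -/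
def Hat.ofNat : ℕ → Hat
  | 0 => .pass
  | n + 1 => .num n

/-- The induced homeomorphism `ω^ω → ω̂^ω`. -/
def toHat (X : ℕ → ℕ) : ℕ → Hat := fun k => Hat.ofNat (X k)

/-- The homeomorphism `ω^ω → ω × ω̂^ω` (first entry, and the translation of the rest). -/
def toNatHat (X : ℕ → ℕ) : ℕ × (ℕ → Hat) := (X 0, toHat fun k => X (k + 1))

/-- Let `X^p ∈ ω^{≤ω}` be the sequence `X` with all `pass`es removed.
`IsEntry X n a` says that `X^p` has an `n`-th entry and that this entry is `a`. -/
def IsEntry (X : ℕ → Hat) (n a : ℕ) : Prop :=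
  ∃ k, X k = Hat.num a ∧ Nat.count (fun j => (X j).isNum = true) k = n

/-- `X^p = Y^p`. -/
def SameP (X Y : ℕ → Hat) : Prop := ∀ n a, IsEntry X n a ↔ IsEntry Y n a

/-- A conciliatory function `ω̂^ω → ω̂^ω`. -/
def Conciliatory (G : (ℕ → Hat) → (ℕ → Hat)) : Prop :=
  ∀ X Y, SameP X Y → SameP (G X) (G Y)

/-- An initializable function: for every finite string `τ` there is a continuous
`θ : ω̂^ω → [τ]` with `(G X)^p = (G (θ X))^p` for all `X`. -/
def Initializable (G : (ℕ → Hat) → (ℕ → Hat)) : Prop :=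
  ∀ τ : List Hat, ∃ θ : (ℕ → Hat) → (ℕ → Hat), Continuous θ ∧
    (∀ (X : ℕ → Hat) (i : ℕ) (hi : i < τ.length), θ X i = τ[i]) ∧
    ∀ X, SameP (G X) (G (θ X))

/-- `U` is `Σ⁰_ξ`-universal: it is `Σ⁰_ξ`-measurable, and every `Σ⁰_ξ`-measurable conciliatory
`G` factors, up to `pass`es, as `U ∘ θ` with `θ` continuous. -/
def Universal (ξ : Ordinal.{0}) (U : (ℕ → Hat) → (ℕ → Hat)) : Prop :=
  Sigma0Measurable ξ U ∧
    ∀ G : (ℕ → Hat) → (ℕ → Hat), Conciliatory G → Sigma0Measurable ξ G →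
      ∃ θ : (ℕ → Hat) → (ℕ → Hat), Continuous θ ∧ ∀ X, SameP (G X) (U (θ X))

/-- For each countable ordinal `α`, a `Σ⁰_{1+ω^α}`-universal initializable conciliatory function
(so a `Σ⁰_2`-universal one for `α = 0`). Values of `U` at uncountable ordinals are irrelevant. -/
def IsUniversalFamily (U : Ordinal.{0} → (ℕ → Hat) → (ℕ → Hat)) : Prop :=
  ∀ α : Ordinal.{0}, α < ω₁ → Conciliatory (U α) ∧ Initializable (U α) ∧ Universal (1 + ω ^ α) (U α)

/-! ### Terms -/

/-- Those terms, in the language with constants `q ∈ 𝒬`, the `ω`-ary symbol `⊔`, the binary symbol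
`→` and the unary symbols `⟨·⟩^{ω^α}` for `α < ω₁`, that are not `⊔`-type and in which `⊔` is
used only directly to the right of `→`: `arrow T F` is the term `T → ⊔ᵢ Fᵢ`. -/
inductive Term (Q : Type u) : Type (max 1 u)
  | const (q : Q) : Term Q
  | jump (α : Ordinal.{0}) (hα : α < ω₁) (T : Term Q) : Term Q
  | arrow (T : Term Q) (F : ℕ → Term Q) : Term Q

/-- Terms that are allowed to be `⊔`-type: either `T`, or `⊔ᵢ Fᵢ`. -/
inductive Forest (Q : Type u) : Type (max 1 u)
  | tree (T : Term Q) : Forest Q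
  | sqcup (F : ℕ → Term Q) : Forest Q

/-- The `⟨⟩`-type terms: constants and terms `⟨T⟩^{ω^α}`. -/
def Term.IsAngle {Q : Type u} : Term Q → Prop
  | .const _ => True
  | .jump _ _ _ => True
  | .arrow _ _ => False

/-- `IsTree R α T`: the term `T` is in `Tree^{ω^α}(R)`, where the elements of `R` (a set of
`⟨⟩`-type terms) play the role of constants. -/
inductive IsTree {Q : Type u} (R : Set (Term Q)) : Ordinal.{0} → Term Q → Prop
  | mono {α β : Ordinal.{0}} {T : Term Q} (hβ : β ≤ α) (hT : IsTree R β T) : IsTree R α T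
  | base {T : Term Q} (hT : T ∈ R) : IsTree R 0 T
  | jump {α β : Ordinal.{0}} {T : Term Q} (hβ : β < α) (hβ₁ : β < ω₁) (hT : IsTree R α T) :
      IsTree R α (Term.jump β hβ₁ T)
  | arrow {α : Ordinal.{0}} {T : Term Q} {F : ℕ → Term Q} (hT : IsTree R α T) (hT' : T.IsAngle)
      (hF : ∀ i, IsTree R α (F i)) : IsTree R α (Term.arrow T F)

/-- The set of constants, `Tree^0(𝒬) = 𝒬`. -/
def constSet (Q : Type u) : Set (Term Q) := Set.range Term.const

/-- `⟨R⟩^{ω^α} = {⟨T⟩^{ω^α} : T ∈ R}`. -/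
def angleSet {Q : Type u} (α : Ordinal.{0}) (R : Set (Term Q)) : Set (Term Q) :=
  {S | ∃ (hα : α < ω₁) (T : Term Q), T ∈ R ∧ S = Term.jump α hα T}

/-- The remainder `β` in `ξ = ω^α + β`, `β < ω^{α+1}`, is smaller than `ξ`. -/
theorem sub_opow_log_lt {ξ : Ordinal.{0}} (hξ : ξ ≠ 0) : ξ - ω ^ Ordinal.log ω ξ < ξ := by
  refine lt_of_le_of_ne (Ordinal.sub_le_self _ _) fun h => ?_
  have h1 : ω ^ Ordinal.log ω ξ ≤ ξ := Ordinal.opow_log_le_self ω hξ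
  have h2 : ω ^ Ordinal.log ω ξ + ξ = ξ := by
    have := Ordinal.add_sub_cancel_of_le h1
    rwa [h] at this
  have h3 : ω ^ Ordinal.log ω ξ * ω ≤ ξ := Ordinal.add_eq_right_iff_mul_omega0_le.1 h2
  have h4 : ξ < ω ^ Order.succ (Ordinal.log ω ξ) :=
    Ordinal.lt_opow_succ_log_self Ordinal.one_lt_omega0 ξ
  rw [Ordinal.opow_succ] at h4
  exact absurd h3 (not_le.2 h4)

open Classical in
/-- `Tree^ξ(𝒬)`. Here `Tree^0(𝒬) = 𝒬`. For `ξ > 0` write `ξ = ω^α + β` with `β < ω^{α+1}`, so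
`α = log_ω ξ`. If `β = 0` this is `Tree^{ω^α}(𝒬)`, and if `β > 0` it is
`Tree^{ω^α}(⟨Tree^β(𝒬)⟩^{ω^α})`. -/
noncomputable def treeXi (Q : Type u) (ξ : Ordinal.{0}) : Set (Term Q) :=
  if hξ : ξ = 0 then constSet Q
  else if ξ - ω ^ Ordinal.log ω ξ = 0 then {T | IsTree (constSet Q) (Ordinal.log ω ξ) T}
  else {T | IsTree (angleSet (Ordinal.log ω ξ) (treeXi Q (ξ - ω ^ Ordinal.log ω ξ)))
    (Ordinal.log ω ξ) T}
termination_by ξ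
decreasing_by exact sub_opow_log_lt hξ

/-- `^⊔Tree^ξ(𝒬)`: the members of `Tree^ξ(𝒬)` and their countable disjoint unions `⊔ᵢ Fᵢ`. -/
def forestXi (Q : Type u) (ξ : Ordinal.{0}) : Set (Forest Q) :=
  {S | (∃ T ∈ treeXi Q ξ, S = Forest.tree T) ∨
    ∃ F : ℕ → Term Q, (∀ i, F i ∈ treeXi Q ξ) ∧ S = Forest.sqcup F}

/-! ### The pointclasses `Σ_T` -/

/-- `OnPart Γ P A`: the restriction `A ↾ P` belongs to `Γ`, for `P ⊆ ω^ω` open or closed and `Γ` a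
class closed under continuous precomposition (as every `Σ_T` is). For nonempty `P`, the function
`A ↾ P` is identified with a total function on `ω^ω`, namely `A ∘ ρ` with `ρ` a continuous
retraction of `ω^ω` onto `P` if `P` is closed, and `A ∘ h` with `h` a homeomorphism from
`ω^ω` onto `P` if `P` is open; that this function is in `Γ` is equivalent to `OnPart Γ P A`, by
the two lemmas that follow. There is no condition if `P` is empty. -/
def OnPart {Q : Type u} (Γ : Set ((ℕ → ℕ) → Q)) (P : Set (ℕ → ℕ)) (A : (ℕ → ℕ) → Q) : Prop :=
  ∀ g : (ℕ → ℕ) → (ℕ → ℕ), Continuous g → (∀ X, g X ∈ P) → A ∘ g ∈ Γ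

theorem onPart_iff_of_retraction {Q : Type u} {Γ : Set ((ℕ → ℕ) → Q)}
    (hΓ : ∀ A ∈ Γ, ∀ θ : (ℕ → ℕ) → (ℕ → ℕ), Continuous θ → A ∘ θ ∈ Γ) {P : Set (ℕ → ℕ)}
    {ρ : (ℕ → ℕ) → (ℕ → ℕ)} (hρ : Continuous ρ) (hρP : ∀ X, ρ X ∈ P) (hρid : ∀ X ∈ P, ρ X = X)
    (A : (ℕ → ℕ) → Q) : OnPart Γ P A ↔ A ∘ ρ ∈ Γ := by
  refine ⟨fun h => h ρ hρ hρP, fun h g hg hgP => ?_⟩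
  have : A ∘ g = (A ∘ ρ) ∘ g := by
    funext X
    simp [hρid _ (hgP X)]
  rw [this]
  exact hΓ _ h g hg

theorem onPart_iff_of_homeomorph {Q : Type u} {Γ : Set ((ℕ → ℕ) → Q)}
    (hΓ : ∀ A ∈ Γ, ∀ θ : (ℕ → ℕ) → (ℕ → ℕ), Continuous θ → A ∘ θ ∈ Γ) {P : Set (ℕ → ℕ)}
    (h : (ℕ → ℕ) ≃ₜ P) (A : (ℕ → ℕ) → Q) :
    OnPart Γ P A ↔ (fun X => A (h X : ℕ → ℕ)) ∈ Γ := by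
  refine ⟨fun H => H (fun X => (h X : ℕ → ℕ)) (continuous_subtype_val.comp h.continuous)
    (fun X => (h X).2), fun H g hg hgP => ?_⟩
  have := hΓ _ H (fun X => h.symm ⟨g X, hgP X⟩)
    (h.symm.continuous.comp (hg.subtype_mk hgP))
  convert this using 1
  funext X
  simp

/-- The class attached to `⊔ᵢ Fᵢ`, given the classes `Γᵢ` attached to the `Fᵢ`: functions `A` for
which there is a partition of `ω^ω` into clopen sets `Cᵢ` (possibly empty) with `A ↾ Cᵢ` in `Γᵢ`. -/
def sumClass {Q : Type u} (Γ : ℕ → Set ((ℕ → ℕ) → Q)) : Set ((ℕ → ℕ) → Q) :=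
  {A | ∃ C : ℕ → Set (ℕ → ℕ), (∀ i, IsClopen (C i)) ∧ Pairwise (Function.onFun Disjoint C) ∧
    (⋃ i, C i) = Set.univ ∧ ∀ i, OnPart (Γ i) (C i) A}

/-- The pointclass `Σ_T`, for `T` not of `⊔`-type. -/
def Term.sigma {Q : Type u} : Term Q → Set ((ℕ → ℕ) → Q)
  | .const q => {fun _ => q}
  | .jump α _ T => {A | ∃ (D : (ℕ → ℕ) → (ℕ → ℕ)) (B : (ℕ → ℕ) → Q),
      Sigma0Measurable (1 + ω ^ α) D ∧ B ∈ T.sigma ∧ A = B ∘ D}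
  | .arrow T F => {A | ∃ V : Set (ℕ → ℕ), IsOpen V ∧ OnPart T.sigma Vᶜ A ∧
      OnPart (sumClass fun i => (F i).sigma) V A}

/-- The pointclass `Σ_T`. -/
def Forest.sigma {Q : Type u} : Forest Q → Set ((ℕ → ℕ) → Q)
  | .tree T => T.sigma
  | .sqcup F => sumClass fun i => (F i).sigma

/-! ### The functions `Ω_T` -/

/-- The clopen sum `⊕ᵢ Aᵢ : ω × ω̂^ω → 𝒬`. -/
def clopenSum {Q : Type u} (A : ℕ → (ℕ → Hat) → Q) (Z : ℕ × (ℕ → Hat)) : Q := A Z.1 Z.2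

open Classical in
/-- The mind-change operation `A → B`, for `A : ω̂^ω → 𝒬` and `B : ω × ω̂^ω → 𝒬`. An input
`⟨2Y(0), …, 2Y(ℓ-1), 2Z(0)+1, Z(1), Z(2), …⟩` codes that the sequence `Y` is dropped at stage `ℓ`
in favour of `Z`, and has value `B(Z)`; an input `⟨2Y(0), 2Y(1), …⟩` without odd entries has value
`A(Y)` (entries `Y(i) = pass` are coded by `pass`). -/
noncomputable def mindChange {Q : Type u} (A : (ℕ → Hat) → Q) (B : ℕ × (ℕ → Hat) → Q)
    (X : ℕ → Hat) : Q :=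
  if h : ∃ l, Odd (X l).val then
    B ((X (Nat.find h)).val / 2, fun k => X (Nat.find h + 1 + k))
  else A fun k => (X k).half

/-- The function `Ω_T : ω̂^ω → 𝒬` for a term `T` not of `⊔`-type, given universal functions `U`. -/
noncomputable def Term.omega {Q : Type u} (U : Ordinal.{0} → (ℕ → Hat) → (ℕ → Hat)) :
    Term Q → (ℕ → Hat) → Q
  | .const q => fun _ => q
  | .jump α _ T => T.omega U ∘ U α
  | .arrow T F => mindChange (T.omega U) (clopenSum fun i => (F i).omega U)

/-- The function `Ω_T`, transported to `ω^ω` along the homeomorphism of `ω^ω` with its domain,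
which is `ω̂^ω` if `T` is not of `⊔`-type, and `ω × ω̂^ω` if `T` is of `⊔`-type. -/
noncomputable def Forest.omega {Q : Type u} (U : Ordinal.{0} → (ℕ → Hat) → (ℕ → Hat)) :
    Forest Q → (ℕ → ℕ) → Q
  | .tree T => T.omega U ∘ toHat
  | .sqcup F => (clopenSum fun i => (F i).omega U) ∘ toNatHat

end Wadge

namespace Wadge

/-! ### Closure properties of the Borel hierarchy -/

section Sigma0

variable {X Y : Type*} [TopologicalSpace X] [TopologicalSpace Y]

/-! Existence. For `1 < ξ < ω₁` there are fixed conditions `P k` on sequences of truth values such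
that every Σ⁰_ξ set is given by `∃ k, P k` applied to membership in a sequence of open sets, each `P
k` defining a Δ⁰_ξ set (`exists_describesDelta0`). Hence a Σ⁰_ξ-measurable `G` is coded by open
sets, and membership in those can be enumerated continuously from the argument. The universal
function reads such an enumeration and searches, entry by entry, for a value with a witness `k`,
passing while it has none. Its tests are Δ⁰_ξ, so it is measurable; they look only at entries, so it
is conciliatory. A symbol `0` erases what was enumerated earlier, which makes it initializable.

Completeness, by induction on `T`. Membership: whether and where an odd entry occurs is an open
event, and its position is continuous on that event. Hardness (`Term.isHard`): for `→`, play doubled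
symbols of a reduction on the closed part until the input is seen to lie in `V`, then play an odd
symbol and switch. For `⟨T⟩`, given `A = B ∘ D` and a reduction `η` of `B`, extend `η ∘ D` up to
passes to a conciliatory measurable function on `ω̂^ω` (`exists_conciliatory_extension`) and factor
that through the universal function. The passes are harmless because `Ω_T` depends only on the
entries of its argument (`Term.omega_congr`). -/

theorem isSigma0_iff {ξ : Ordinal.{0}} {S : Set X} :
    IsSigma0 ξ S ↔ (ξ = 1 ∧ IsOpen S) ∨ ∃ (β : ℕ → Ordinal.{0}) (T : ℕ → Set X),
      (∀ n, β n < ξ) ∧ (∀ n, IsSigma0 (β n) (T n)ᶜ) ∧ S = ⋃ n, T n := by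
  constructor
  · intro h
    cases h with
    | of_isOpen hS => exact Or.inl ⟨rfl, hS⟩
    | iUnion_compl β T hβ hT => exact Or.inr ⟨β, T, hβ, hT, rfl⟩
  · rintro (⟨rfl, h⟩ | ⟨β, T, hβ, hT, rfl⟩)
    · exact .of_isOpen h
    · exact .iUnion_compl β T hβ hT

theorem IsSigma0.ne_zero {ξ : Ordinal.{0}} {S : Set X} (h : IsSigma0 ξ S) : ξ ≠ 0 := by
  rcases isSigma0_iff.1 h with ⟨rfl, -⟩ | ⟨β, -, hβ, -⟩
  · exact one_ne_zero
  · exact (lt_of_le_of_lt (zero_le) (hβ 0)).ne'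

theorem IsSigma0.one_le {ξ : Ordinal.{0}} {S : Set X} (h : IsSigma0 ξ S) : 1 ≤ ξ :=
  Order.one_le_iff_ne_zero.2 h.ne_zero

theorem isSigma0_one {S : Set X} : IsSigma0 1 S ↔ IsOpen S := by
  refine ⟨fun h => ?_, .of_isOpen⟩
  rcases isSigma0_iff.1 h with ⟨-, h⟩ | ⟨β, T, hβ, hT, -⟩
  · exact h
  · exact absurd (hβ 0) (not_lt.2 (hT 0).one_le)

theorem isSigma0_of_one_lt {ξ : Ordinal.{0}} (hξ : 1 < ξ) {S : Set X} (h : IsSigma0 ξ S) :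
    ∃ (β : ℕ → Ordinal.{0}) (T : ℕ → Set X),
      (∀ n, β n < ξ) ∧ (∀ n, IsSigma0 (β n) (T n)ᶜ) ∧ S = ⋃ n, T n := by
  rcases isSigma0_iff.1 h with ⟨rfl, -⟩ | h
  · exact absurd hξ (lt_irrefl _)
  · exact h

theorem IsSigma0.preimage {ξ : Ordinal.{0}} {S : Set Y} (h : IsSigma0 ξ S) {f : X → Y}
    (hf : Continuous f) : IsSigma0 ξ (f ⁻¹' S) := by
  induction h with
  | of_isOpen hS => exact .of_isOpen (hS.preimage hf)
  | iUnion_compl β T hβ hT ih =>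
    rw [Set.preimage_iUnion]
    exact .iUnion_compl β _ hβ ih

theorem IsSigma0.compl {β ξ : Ordinal.{0}} {S : Set X} (h : IsSigma0 β S) (hβ : β < ξ) :
    IsSigma0 ξ Sᶜ := by
  have := IsSigma0.iUnion_compl (ξ := ξ) (fun _ => β) (fun _ => Sᶜ) (fun _ => hβ)
    (fun _ => by rwa [compl_compl])
  rwa [Set.iUnion_const] at this

theorem IsSigma0.iUnion {ξ : Ordinal.{0}} {S : ℕ → Set X} (h : ∀ n, IsSigma0 ξ (S n)) :
    IsSigma0 ξ (⋃ n, S n) := by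
  rcases (h 0).one_le.eq_or_lt with rfl | hξ
  · exact .of_isOpen (isOpen_iUnion fun n => isSigma0_one.1 (h n))
  · choose β T hβ hT hS using fun n => isSigma0_of_one_lt hξ (h n)
    have := IsSigma0.iUnion_compl (ξ := ξ) (fun k => β k.unpair.1 k.unpair.2)
      (fun k => T k.unpair.1 k.unpair.2) (fun k => hβ _ _) (fun k => hT _ _)
    convert this using 1
    rw [Set.iUnion_unpair (fun i j => T i j)]
    exact Set.iUnion_congr hS

theorem IsSigma0.iUnion_countable {ι : Type*} [Countable ι] {ξ : Ordinal.{0}}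
    {S : ι → Set X} (h : ∀ n, IsSigma0 ξ (S n)) (hempty : IsSigma0 ξ (∅ : Set X)) :
    IsSigma0 ξ (⋃ n, S n) := by
  rcases isEmpty_or_nonempty ι with hι | hι
  · rwa [Set.iUnion_of_empty]
  · obtain ⟨e, he⟩ := exists_surjective_nat ι
    rw [← he.iUnion_comp]
    exact .iUnion fun n => h _

/-- The set `S` is (boldface) `Δ⁰_ξ`. -/
def IsDelta0 (ξ : Ordinal.{0}) (S : Set X) : Prop := IsSigma0 ξ S ∧ IsSigma0 ξ Sᶜ

theorem IsDelta0.compl {ξ : Ordinal.{0}} {S : Set X} (h : IsDelta0 ξ S) : IsDelta0 ξ Sᶜ :=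
  ⟨h.2, by rw [compl_compl]; exact h.1⟩

/-- Every set of fibres of `f` has a `Σ⁰_ξ` union. -/
def Sigma0Discrete {C : Type*} (ξ : Ordinal.{0}) (f : X → C) : Prop :=
  ∀ A : Set C, IsSigma0 ξ (f ⁻¹' A)

theorem Sigma0Discrete.comp {C E : Type*} {ξ : Ordinal.{0}} {f : X → C}
    (hf : Sigma0Discrete ξ f) (h : C → E) : Sigma0Discrete ξ fun x => h (f x) :=
  fun A => hf (h ⁻¹' A)

variable [TopologicalSpace.MetrizableSpace X]

/-- Metrizability is needed only to leave level 1: open sets are countable unions of closed sets.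
Above that the definition is visibly monotone. -/
theorem IsSigma0.mono {β ξ : Ordinal.{0}} {S : Set X} (h : IsSigma0 β S) (hβ : β ≤ ξ) :
    IsSigma0 ξ S := by
  rcases hβ.eq_or_lt with rfl | hβ
  · exact h
  rcases isSigma0_iff.1 h with ⟨rfl, hS⟩ | ⟨γ, T, hγ, hT, rfl⟩
  · let := TopologicalSpace.metrizableSpaceMetric X
    obtain ⟨F, hF, -, rfl, -⟩ := hS.exists_iUnion_isClosed
    exact .iUnion_compl (fun _ => 1) F (fun _ => hβ) fun n => .of_isOpen (hF n).isOpen_compl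
  · exact .iUnion_compl γ T (fun n => (hγ n).trans hβ) hT

theorem IsSigma0.of_isOpen' {ξ : Ordinal.{0}} (hξ : 1 ≤ ξ) {S : Set X} (hS : IsOpen S) :
    IsSigma0 ξ S :=
  (IsSigma0.of_isOpen hS).mono hξ

theorem IsSigma0.union {ξ : Ordinal.{0}} {S T : Set X} (hS : IsSigma0 ξ S) (hT : IsSigma0 ξ T) :
    IsSigma0 ξ (S ∪ T) := by
  rw [Set.union_eq_iUnion]
  refine .iUnion_countable (fun b => ?_) (.of_isOpen' hS.one_le isOpen_empty)
  cases b <;> assumption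

theorem IsSigma0.inter {ξ : Ordinal.{0}} {S T : Set X} (hS : IsSigma0 ξ S) (hT : IsSigma0 ξ T) :
    IsSigma0 ξ (S ∩ T) := by
  rcases hS.one_le.eq_or_lt with rfl | hξ
  · exact .of_isOpen ((isSigma0_one.1 hS).inter (isSigma0_one.1 hT))
  obtain ⟨β, S, hβ, hS', rfl⟩ := isSigma0_of_one_lt hξ hS
  obtain ⟨γ, T, hγ, hT', rfl⟩ := isSigma0_of_one_lt hξ hT
  rw [Set.iUnion_inter_iUnion]
  refine .iUnion fun i => .iUnion fun j => ?_
  have := ((hS' i).mono (le_max_left (β i) (γ j))).union ((hT' j).mono (le_max_right _ _))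
  have h2 := this.compl (max_lt (hβ i) (hγ j))
  rwa [Set.compl_union, compl_compl, compl_compl] at h2

theorem IsDelta0.inter {ξ : Ordinal.{0}} {S T : Set X} (hS : IsDelta0 ξ S) (hT : IsDelta0 ξ T) :
    IsDelta0 ξ (S ∩ T) :=
  ⟨hS.1.inter hT.1, by rw [Set.compl_inter]; exact hS.2.union hT.2⟩

theorem IsSigma0.isDelta0 {β ξ : Ordinal.{0}} {S : Set X} (h : IsSigma0 β S) (hβ : β < ξ) :
    IsDelta0 ξ S :=
  ⟨h.mono hβ.le, h.compl hβ⟩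

theorem sigma0Discrete_of_fibres {C : Type*} [Countable C] {ξ : Ordinal.{0}} (hξ : 1 ≤ ξ)
    {f : X → C} (hf : ∀ c, IsSigma0 ξ (f ⁻¹' {c})) : Sigma0Discrete ξ f := by
  intro A
  have : f ⁻¹' A = ⋃ a : A, f ⁻¹' {(a : C)} := by ext x; simp
  rw [this]
  exact .iUnion_countable (fun a => hf a) (.of_isOpen' hξ isOpen_empty)

theorem sigma0Discrete_const {C : Type*} {ξ : Ordinal.{0}} (hξ : 1 ≤ ξ) (c : C) :
    Sigma0Discrete ξ fun _ : X => c := by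
  intro A
  by_cases hc : c ∈ A
  · simpa [hc] using IsSigma0.of_isOpen' hξ (isOpen_univ (X := X))
  · simpa [hc] using IsSigma0.of_isOpen' hξ (isOpen_empty (X := X))

theorem Sigma0Discrete.prodMk {C E : Type*} [Countable C] [Countable E] {ξ : Ordinal.{0}}
    (hξ : 1 ≤ ξ) {f : X → C} {g : X → E} (hf : Sigma0Discrete ξ f) (hg : Sigma0Discrete ξ g) :
    Sigma0Discrete ξ fun x => (f x, g x) := by
  refine sigma0Discrete_of_fibres hξ fun ⟨c, e⟩ => ?_
  convert (hf {c}).inter (hg {e}) using 1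
  ext x
  simp

/-- A function to a sequence space over a countable discrete alphabet is `Σ⁰_ξ`-measurable if all
its coordinates are. -/
theorem sigma0Measurable_pi {C : Type*} [Countable C] [TopologicalSpace C] [DiscreteTopology C]
    {ξ : Ordinal.{0}} (hξ : 1 ≤ ξ) {f : X → ℕ → C}
    (hf : ∀ k, Sigma0Discrete ξ fun x => f x k) : Sigma0Measurable ξ f := by
  have hres : ∀ n, Sigma0Discrete ξ fun x => PiNat.res (f x) n := by
    intro n
    induction n with
    | zero => exact sigma0Discrete_const hξ _
    | succ n ih => exact ((hf n).prodMk hξ ih).comp fun p => p.1 :: p.2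
  intro V hV
  have : f ⁻¹' V = ⋃ n, (fun x => PiNat.res (f x) n) ⁻¹'
      {l | ∀ y, PiNat.res y n = l → y ∈ V} := by
    ext x
    simp only [Set.mem_preimage, Set.mem_iUnion, Set.mem_ofPred_eq]
    constructor
    · intro hx
      obtain ⟨_, ⟨y, n, rfl⟩, hy, hyV⟩ :=
        (PiNat.isTopologicalBasis_cylinders (fun _ : ℕ => C)).exists_subset_of_mem_open hx hV
      refine ⟨n, fun z hz => hyV ?_⟩
      rw [PiNat.cylinder_eq_res] at hy ⊢
      exact hz.trans hy
    · rintro ⟨n, h⟩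
      exact h _ rfl
  rw [this]
  exact .iUnion fun n => hres n _

end Sigma0

/-! ### Entries of a sequence with passes -/

theorem IsEntry.unique {X : ℕ → Hat} {n a b : ℕ} (ha : IsEntry X n a) (hb : IsEntry X n b) :
    a = b := by
  obtain ⟨k, hk, hkn⟩ := ha
  obtain ⟨l, hl, hln⟩ := hb
  have hkl : k = l := Nat.count_injective (p := fun j => (X j).isNum = true)
    (by simp [hk, Hat.isNum]) (by simp [hl, Hat.isNum]) (hkn.trans hln.symm)
  subst hkl
  rw [hk] at hl
  exact Hat.num.inj hl

theorem isEntry_count {X : ℕ → Hat} {k a : ℕ} (h : X k = Hat.num a) :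
    IsEntry X (Nat.count (fun j => (X j).isNum = true) k) a := ⟨k, h, rfl⟩

theorem IsEntry.exists_lt {X : ℕ → Hat} {n a m : ℕ} (h : IsEntry X n a) (hm : m < n) :
    ∃ b, IsEntry X m b := by
  obtain ⟨k, -, hk⟩ := h
  rw [← hk] at hm
  clear hk
  induction k with
  | zero => simp at hm
  | succ k ih =>
    rw [Nat.count_succ] at hm
    by_cases hlt : m < Nat.count (fun j => (X j).isNum = true) k
    · exact ih hlt
    · cases hX : X k with
      | pass =>
        rw [if_neg (by simp [hX, Hat.isNum])] at hm
        exact absurd hm hlt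
      | num b =>
        rw [if_pos (by simp [hX, Hat.isNum])] at hm
        exact ⟨b, k, hX, by omega⟩

theorem isEntry_num {X : ℕ → ℕ} {n a : ℕ} : IsEntry (fun k => Hat.num (X k)) n a ↔ X n = a := by
  have : ∀ k, Nat.count (fun j => (Hat.num (X j)).isNum = true) k = k := fun k => by
    simp [Hat.isNum]
  simp [IsEntry, this]

theorem isEntry_tail {X : ℕ → Hat} {l n a : ℕ} : IsEntry (fun k => X (l + k)) n a ↔
    IsEntry X (Nat.count (fun j => (X j).isNum = true) l + n) a := by
  constructor
  · rintro ⟨k, hk, rfl⟩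
    exact ⟨l + k, hk, Nat.count_add _ _ _⟩
  · rintro ⟨k, hk, hn⟩
    have hlk : l ≤ k := by
      by_contra! hlt
      have := Nat.count_strict_mono (p := fun j => (X j).isNum = true)
        (by simp [hk, Hat.isNum]) hlt
      omega
    obtain ⟨k, rfl⟩ := Nat.exists_eq_add_of_le hlk
    refine ⟨k, hk, ?_⟩
    rw [Nat.count_add] at hn
    exact Nat.add_left_cancel hn

theorem SameP.symm {X Y : ℕ → Hat} (h : SameP X Y) : SameP Y X := fun n a => (h n a).symm

theorem SameP.trans {X Y Z : ℕ → Hat} (h : SameP X Y) (h' : SameP Y Z) : SameP X Z :=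
  fun n a => (h n a).trans (h' n a)

/-- A function to a sequence space over a discrete alphabet is continuous if its values are
determined locally by finite prefixes of the input. -/
theorem continuous_of_cylinder {α β : Type*} [TopologicalSpace α] [DiscreteTopology α]
    [TopologicalSpace β] {f : (ℕ → α) → β}
    (hf : ∀ x, ∃ n, ∀ y ∈ PiNat.cylinder x n, f y = f x) : Continuous f := by
  refine IsLocallyConstant.continuous ((IsLocallyConstant.iff_exists_open _).2 fun x => ?_)
  obtain ⟨n, hn⟩ := hf x
  exact ⟨_, PiNat.isOpen_cylinder _ x n, PiNat.self_mem_cylinder x n, hn⟩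

theorem exists_cylinder_subset {α : Type*} [TopologicalSpace α] [DiscreteTopology α]
    {O : Set (ℕ → α)} (hO : IsOpen O) {x : ℕ → α} (hx : x ∈ O) :
    ∃ n, PiNat.cylinder x n ⊆ O := by
  obtain ⟨_, ⟨y, n, rfl⟩, hy, hyV⟩ :=
    (PiNat.isTopologicalBasis_cylinders (fun _ : ℕ => α)).exists_subset_of_mem_open hx hO
  exact ⟨n, by rwa [PiNat.mem_cylinder_iff_eq.1 hy]⟩

theorem isOpen_isEntry (n a : ℕ) : IsOpen {X : ℕ → Hat | IsEntry X n a} := by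
  have hc : ∀ k, Continuous fun X : ℕ → Hat =>
      (X k, Nat.count (fun j => (X j).isNum = true) k) := by
    refine fun k => continuous_of_cylinder fun X => ⟨k + 1, fun Y hY => ?_⟩
    rw [PiNat.mem_cylinder_iff] at hY
    have hk : Nat.count (fun j => (Y j).isNum = true) k =
        Nat.count (fun j => (X j).isNum = true) k := by
      apply le_antisymm <;>
      exact Nat.count_mono_left fun j hj h => by simpa [hY j (by omega)] using h
    simp [hY k (by omega), hk]
  convert isOpen_iUnion fun k => (isOpen_discrete {(Hat.num a, n)}).preimage (hc k) using 1
  ext X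
  simp [IsEntry]

/-! ### Searching for the entries of a sequence -/

open Classical in
/-- One step of a search: at `(n, j)`, proceed to the next entry if `j` is a witness for the
current one, and to the next candidate otherwise. -/
noncomputable def searchStep (p : (ℕ × ℕ) × Prop) : ℕ × ℕ :=
  if p.2 then (p.1.1 + 1, 0) else (p.1.1, p.1.2 + 1)

/-- The entry and the candidate considered at stage `s` of the search. -/
noncomputable def searchState (v : ℕ → ℕ → Prop) : ℕ → ℕ × ℕ
  | 0 => (0, 0)
  | s + 1 => searchStep (searchState v s, v (searchState v s).1 (searchState v s).2)

open Classical in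
/-- The output at a given stage, for `p` the current state and the success of the candidate. -/
noncomputable def searchOutput (p : (ℕ × ℕ) × Prop) : Hat :=
  if p.2 then .num p.1.2.unpair.1 else .pass

/-- The sequence whose `n`-th entry is `j.unpair.1` for the least `j` with `v n j`, up to the first
`n` for which there is no such `j`. -/
noncomputable def search (v : ℕ → ℕ → Prop) (s : ℕ) : Hat :=
  searchOutput (searchState v s, v (searchState v s).1 (searchState v s).2)

theorem count_search (v : ℕ → ℕ → Prop) (s : ℕ) :
    Nat.count (fun j => (search v j).isNum = true) s = (searchState v s).1 := by
  induction s with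
  | zero => simp [searchState]
  | succ s ih =>
    rw [Nat.count_succ, ih, searchState, searchStep]
    by_cases h : v (searchState v s).1 (searchState v s).2 <;>
      simp [search, searchOutput, h, Hat.isNum]

theorem exists_of_isEntry_search {v : ℕ → ℕ → Prop} {n a : ℕ} (h : IsEntry (search v) n a) :
    ∃ j, v n j ∧ j.unpair.1 = a := by
  obtain ⟨s, hs, hn⟩ := h
  rw [count_search] at hn
  rw [search, searchOutput] at hs
  split_ifs at hs with hv
  refine ⟨_, ?_, Hat.num.inj hs⟩
  rwa [hn] at hv

theorem searchState_add {v : ℕ → ℕ → Prop} {n s i : ℕ} (hs : searchState v s = (n, 0))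
    (hi : ∀ j < i, ¬ v n j) : searchState v (s + i) = (n, i) := by
  induction i with
  | zero => exact hs
  | succ i ih =>
    have := ih fun j hj => hi j (by omega)
    rw [← add_assoc, searchState, this, searchStep, if_neg (hi i (by omega))]

theorem exists_searchState {v : ℕ → ℕ → Prop} {n : ℕ} (h : ∀ m < n, ∃ j, v m j) :
    ∃ s, searchState v s = (n, 0) := by
  classical
  induction n with
  | zero => exact ⟨0, rfl⟩
  | succ n ih =>
    obtain ⟨s, hs⟩ := ih fun m hm => h m (by omega)
    have hv := h n (by omega)
    refine ⟨s + Nat.find hv + 1, ?_⟩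
    rw [searchState, searchState_add hs fun j hj => Nat.find_min hv hj, searchStep,
      if_pos (Nat.find_spec hv)]

/-- All witnesses for `n` name the same value, the true entry, so finding the least one suffices.
The search reaches `n` because the entries of `Y` occupy an initial segment of `ℕ`. -/
theorem sameP_search {v : ℕ → ℕ → Prop} {Y : ℕ → Hat}
    (h : ∀ n a, IsEntry Y n a ↔ ∃ j, v n j ∧ j.unpair.1 = a) : SameP Y (search v) := by
  classical
  intro n a
  refine ⟨fun hY => ?_, fun hs => (h n a).2 (exists_of_isEntry_search hs)⟩
  have hm : ∀ m ≤ n, ∃ j, v m j := by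
    intro m hm
    obtain ⟨b, hb⟩ : ∃ b, IsEntry Y m b := by
      rcases hm.eq_or_lt with rfl | hm
      · exact ⟨a, hY⟩
      · exact hY.exists_lt hm
    obtain ⟨j, hj, -⟩ := (h m b).1 hb
    exact ⟨j, hj⟩
  obtain ⟨s, hs⟩ := exists_searchState fun m (hmn : m < n) => hm m hmn.le
  have hv := hm n le_rfl
  have hst := searchState_add hs fun j hj => Nat.find_min hv hj
  have he : IsEntry (search v) n (Nat.find hv).unpair.1 := by
    refine ⟨s + Nat.find hv, ?_, by rw [count_search, hst]⟩
    rw [search, searchOutput, hst, if_pos (Nat.find_spec hv)]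
  obtain rfl := hY.unique ((h _ _).2 (exists_of_isEntry_search he))
  exact he

section

variable {X : Type*} [TopologicalSpace X] [TopologicalSpace.MetrizableSpace X]

/-- Runs a test that depends on the current state. Δ⁰_ξ is required since both outcomes must be
Σ⁰_ξ. -/
theorem Sigma0Discrete.prodMk_mem {C : Type*} [Countable C] {ξ : Ordinal.{0}} (hξ : 1 ≤ ξ)
    {f : X → C} (hf : Sigma0Discrete ξ f) {V : C → Set X} (hV : ∀ c, IsDelta0 ξ (V c)) :
    Sigma0Discrete ξ fun x => (f x, x ∈ V (f x)) := by
  refine sigma0Discrete_of_fibres hξ fun ⟨c, P⟩ => ?_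
  by_cases hP : P
  · convert (hf {c}).inter (hV c).1 using 1
    ext x
    simp only [Set.mem_preimage, Set.mem_singleton_iff, Prod.mk.injEq, Set.mem_inter_iff, hP,
      eq_iff_iff, iff_true]
    exact and_congr_right fun h => by rw [h]
  · convert (hf {c}).inter (hV c).2 using 1
    ext x
    simp only [Set.mem_preimage, Set.mem_singleton_iff, Prod.mk.injEq, Set.mem_inter_iff, hP,
      eq_iff_iff, iff_false, Set.mem_compl_iff]
    exact and_congr_right fun h => by rw [h]

instance : Countable Hat :=
  Function.Surjective.countable (f := Hat.ofNat) fun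
    | .pass => ⟨0, rfl⟩
    | .num n => ⟨n + 1, rfl⟩

theorem sigma0Measurable_search {ξ : Ordinal.{0}} (hξ : 1 ≤ ξ) {V : ℕ → ℕ → Set X}
    (hV : ∀ n j, IsDelta0 ξ (V n j)) :
    Sigma0Measurable ξ fun x => search fun n j => x ∈ V n j := by
  have hst : ∀ s, Sigma0Discrete ξ fun x => searchState (fun n j => x ∈ V n j) s := by
    intro s
    induction s with
    | zero => exact sigma0Discrete_const hξ _
    | succ s ih =>
      exact (ih.prodMk_mem hξ (V := fun p => V p.1 p.2) fun p => hV _ _).comp searchStep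
  exact sigma0Measurable_pi hξ fun s =>
    ((hst s).prodMk_mem hξ (V := fun p => V p.1 p.2) fun p => hV _ _).comp searchOutput

end

/-! ### Uniform description of the Borel classes by sequences of open sets -/

/-- `W` describes the class `Σ⁰_ξ`: a set `S` is `Σ⁰_ξ` iff there are open sets `O N` such that
`x ∈ S` is equivalent to the condition `W` on the truth values of the statements `x ∈ O N`. -/
def DescribesSigma0 (ξ : Ordinal.{0}) (W : (ℕ → Prop) → Prop) : Prop :=
  ∀ (X : Type) [TopologicalSpace X] [TopologicalSpace.MetrizableSpace X] (S : Set X),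
    IsSigma0 ξ S ↔ ∃ O : ℕ → Set X, (∀ N, IsOpen (O N)) ∧ S = {x | W fun N => x ∈ O N}

/-- For `ξ > 1`, the class `Σ⁰_ξ` is described by `∃ k, P k`, with conditions `P k` that describe
`Δ⁰_ξ` sets. -/
def DescribesDelta0 (ξ : Ordinal.{0}) (P : ℕ → (ℕ → Prop) → Prop) : Prop :=
  ∀ (X : Type) [TopologicalSpace X] [TopologicalSpace.MetrizableSpace X],
    (∀ S : Set X, IsSigma0 ξ S →
      ∃ O : ℕ → Set X, (∀ N, IsOpen (O N)) ∧ S = {x | ∃ k, P k fun N => x ∈ O N}) ∧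
    ∀ O : ℕ → Set X, (∀ N, IsOpen (O N)) → ∀ k, IsDelta0 ξ {x | P k fun N => x ∈ O N}

theorem countable_Iio_of_lt_omega_one {ξ : Ordinal.{0}} (hξ : ξ < ω₁) : (Set.Iio ξ).Countable := by
  rw [← Cardinal.le_aleph0_iff_set_countable, Cardinal.mk_Iio_ordinal, Cardinal.lift_le_aleph0]
  rw [← Cardinal.ord_aleph, Cardinal.lt_ord] at hξ
  rw [← Order.lt_succ_iff, Cardinal.succ_aleph0]
  exact hξ

/-- The levels `β n` vary with the set, while `P` may not. So `k` codes a level, taken from a fixed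
enumeration `f` of the nonzero levels below `ξ`, together with an index `n`. The slot `k` holds `T
n` if its level is `β n`, and the empty set otherwise. -/
theorem exists_describesDelta0_of_lt {ξ : Ordinal.{0}} (hξ : 1 < ξ) (hξ₁ : ξ < ω₁)
    (ih : ∀ γ < ξ, 1 ≤ γ → ∃ W, DescribesSigma0 γ W) : ∃ P, DescribesDelta0 ξ P := by
  classical
  have hc : Countable {γ : Ordinal.{0} // γ < ξ ∧ 1 ≤ γ} :=
    ((countable_Iio_of_lt_omega_one hξ₁).mono fun γ (h : γ < ξ ∧ 1 ≤ γ) => h.1).to_subtype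
  have hne : Nonempty {γ : Ordinal.{0} // γ < ξ ∧ 1 ≤ γ} := ⟨⟨1, hξ, le_rfl⟩⟩
  obtain ⟨f, hf⟩ := exists_surjective_nat {γ : Ordinal.{0} // γ < ξ ∧ 1 ≤ γ}
  choose W hW using fun γ : {γ : Ordinal.{0} // γ < ξ ∧ 1 ≤ γ} => ih γ.1 γ.2.1 γ.2.2
  -- Each `k` reads its own block of `e`, so the open sets for different slots can be chosen
  -- independently.
  refine ⟨fun k e => ¬ W (f k.unpair.1) fun N => e (Nat.pair k N), fun X _ _ => ⟨?_, ?_⟩⟩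
  · intro S hS
    obtain ⟨β, T, hβ, hT, rfl⟩ := isSigma0_of_one_lt hξ hS
    have key : ∀ k : ℕ, ∃ O : ℕ → Set X, (∀ N, IsOpen (O N)) ∧
        (if (f k.unpair.1 : Ordinal.{0}) = β k.unpair.2 then (T k.unpair.2)ᶜ else Set.univ) =
          {x | W (f k.unpair.1) fun N => x ∈ O N} := by
      intro k
      refine (hW _ X _).1 ?_
      split_ifs with h
      · rw [h]
        exact hT _
      · exact .of_isOpen' (f _).2.2 isOpen_univ
    choose O hO hOW using key
    refine ⟨fun N => O N.unpair.1 N.unpair.2, fun N => hO _ _, ?_⟩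
    ext x
    have hx : ∀ k, (¬ W (f k.unpair.1) fun N => x ∈ O k N) ↔
        (f k.unpair.1 : Ordinal.{0}) = β k.unpair.2 ∧ x ∈ T k.unpair.2 := by
      intro k
      have : x ∈ {x | W (f k.unpair.1) fun N => x ∈ O k N} ↔ W (f k.unpair.1) fun N => x ∈ O k N :=
        Iff.rfl
      rw [← this, ← hOW k]
      split_ifs with h <;> simp [h]
    simp only [Set.mem_iUnion, Nat.unpair_pair, Set.mem_ofPred_eq, hx]
    constructor
    · rintro ⟨n, hn⟩
      obtain ⟨i, hi⟩ := hf ⟨β n, hβ n, (hT n).one_le⟩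
      exact ⟨Nat.pair i n, by simp [hi], by simpa using hn⟩
    · rintro ⟨k, -, hk⟩
      exact ⟨_, hk⟩
  · intro O hO k
    exact (((hW (f k.unpair.1) X _).2 ⟨_, fun N => hO (Nat.pair k N), rfl⟩).isDelta0
      (f k.unpair.1).2.1).compl

theorem exists_describesSigma0 (ξ : Ordinal.{0}) (hξ : 1 ≤ ξ) (hξ₁ : ξ < ω₁) :
    ∃ W, DescribesSigma0 ξ W := by
  induction ξ using WellFoundedLT.induction with
  | ind ξ ih =>
    rcases hξ.eq_or_lt with rfl | hξ
    · refine ⟨fun e => e 0, fun X _ _ S => ⟨fun hS => ?_, ?_⟩⟩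
      · exact ⟨fun _ => S, fun _ => isSigma0_one.1 hS, rfl⟩
      · rintro ⟨O, hO, rfl⟩
        exact .of_isOpen (hO 0)
    · obtain ⟨P, hP⟩ := exists_describesDelta0_of_lt hξ hξ₁ fun γ hγ h1 => ih γ hγ h1 (hγ.trans hξ₁)
      refine ⟨fun e => ∃ k, P k e, fun X _ _ S => ⟨(hP X).1 S, ?_⟩⟩
      rintro ⟨O, hO, rfl⟩
      convert IsSigma0.iUnion fun k => ((hP X).2 O hO k).1 using 1
      ext
      simp

theorem exists_describesDelta0 {ξ : Ordinal.{0}} (hξ : 1 < ξ) (hξ₁ : ξ < ω₁) :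
    ∃ P, DescribesDelta0 ξ P :=
  exists_describesDelta0_of_lt hξ hξ₁ fun γ hγ h1 => exists_describesSigma0 γ h1 (hγ.trans hξ₁)

/-- The entries of the values of a `Σ⁰_ξ`-measurable function, described by open sets. -/
theorem DescribesDelta0.exists_isEntry_iff {ξ : Ordinal.{0}} {P : ℕ → (ℕ → Prop) → Prop}
    (hP : DescribesDelta0 ξ P) {X : Type} [TopologicalSpace X] [TopologicalSpace.MetrizableSpace X]
    {G : X → ℕ → Hat} (hG : Sigma0Measurable ξ G) :
    ∃ O : ℕ → Set X, (∀ N, IsOpen (O N)) ∧ ∀ x n a, IsEntry (G x) n a ↔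
      ∃ k, P k fun N => x ∈ O (Nat.pair (Nat.pair n a) N) := by
  choose O hO hOG using fun n a => (hP X).1 _ (hG _ (isOpen_isEntry n a))
  refine ⟨fun M => O M.unpair.1.unpair.1 M.unpair.1.unpair.2 M.unpair.2, fun M => hO _ _ _,
    fun x n a => ?_⟩
  have : x ∈ G ⁻¹' {X | IsEntry X n a} ↔ IsEntry (G x) n a := Iff.rfl
  rw [← this, hOG]
  simp

/-! ### Existence of universal functions -/

/-- The condition under which the universal function attached to `P` recognizes `q` as a witness
for `a` being its `n`-th entry. The input `Z` enumerates a set of numbers, after the last entry `0`,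
whose position is guessed by `q`. -/
def universalCond (P : ℕ → (ℕ → Prop) → Prop) (n j : ℕ) : Set (ℕ → Hat) :=
  {Z | (IsEntry Z j.unpair.2.unpair.1 0 ∧ ∀ i > j.unpair.2.unpair.1, ¬ IsEntry Z i 0) ∧
    P j.unpair.2.unpair.2 fun N => ∃ i > j.unpair.2.unpair.1,
      IsEntry Z i (Nat.pair (Nat.pair n j.unpair.1) N + 1)}

/-- The universal function attached to a description `P` of `Σ⁰_ξ`. -/
noncomputable def universalFun (P : ℕ → (ℕ → Prop) → Prop) (Z : ℕ → Hat) : ℕ → Hat :=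
  search fun n j => Z ∈ universalCond P n j

theorem conciliatory_universalFun (P : ℕ → (ℕ → Prop) → Prop) : Conciliatory (universalFun P) := by
  intro Z Z' h
  have : ∀ n j, Z ∈ universalCond P n j ↔ Z' ∈ universalCond P n j := fun n j => by
    simp only [universalCond, Set.mem_ofPred_eq, h _ _]
  simp only [universalFun, this]
  exact fun _ _ => Iff.rfl

theorem sigma0Measurable_universalFun {ξ : Ordinal.{0}} (hξ : 1 < ξ)
    {P : ℕ → (ℕ → Prop) → Prop} (hP : DescribesDelta0 ξ P) :
    Sigma0Measurable ξ (universalFun P) := by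
  refine sigma0Measurable_search hξ.le fun n j => ?_
  have h1 : ∀ O : Set (ℕ → Hat), IsOpen O → IsDelta0 ξ O := fun O hO =>
    (IsSigma0.of_isOpen hO).isDelta0 hξ
  have h3 : ∀ r a, IsOpen {Z : ℕ → Hat | ∃ i > r, IsEntry Z i a} := fun r a => by
    have : {Z : ℕ → Hat | ∃ i > r, IsEntry Z i a} = ⋃ (i : ℕ) (_ : i > r), {Z | IsEntry Z i a} := by
      ext Z
      simp
    rw [this]
    exact isOpen_iUnion fun i => isOpen_iUnion fun _ => isOpen_isEntry i a
  -- The position of the last `0` is correct on an intersection of an open and a closed set, which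
  -- is Δ⁰_ξ since `1 < ξ`.
  have h4 : universalCond P n j = ({Z | IsEntry Z j.unpair.2.unpair.1 0} ∩
      {Z | ∃ i > j.unpair.2.unpair.1, IsEntry Z i 0}ᶜ) ∩ {Z | P j.unpair.2.unpair.2 fun N =>
        Z ∈ {Z | ∃ i > j.unpair.2.unpair.1,
          IsEntry Z i (Nat.pair (Nat.pair n j.unpair.1) N + 1)}} := by
    ext Z
    simp [universalCond]
  rw [h4]
  exact ((h1 _ (isOpen_isEntry _ _)).inter (h1 _ (h3 _ _)).compl).inter
    ((hP _).2 _ (fun N => h3 _ _) _)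

open Classical in
/-- The sequence that starts with `τ` and `0` and then enumerates the (successors of the) numbers
`N` with `x ∈ O N`. -/
noncomputable def enumerateAfter (τ : List Hat) (O : ℕ → Set (ℕ → Hat)) (x : ℕ → Hat) (i : ℕ) :
    Hat :=
  if h : i < τ.length then τ[i]
  else if i = τ.length then .num 0
  else if PiNat.cylinder x (i - (τ.length + 1)).unpair.2 ⊆ O (i - (τ.length + 1)).unpair.1 then
    .num ((i - (τ.length + 1)).unpair.1 + 1)
  else .pass

theorem continuous_enumerateAfter (τ : List Hat) (O : ℕ → Set (ℕ → Hat)) :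
    Continuous (enumerateAfter τ O) := by
  refine continuous_pi fun i => continuous_of_cylinder fun x =>
    ⟨(i - (τ.length + 1)).unpair.2, fun y hy => ?_⟩
  rw [enumerateAfter, enumerateAfter, PiNat.mem_cylinder_iff_eq.1 hy]

/-- The string `τ` may itself contain zeros, but the `0` at place `τ.length` is the last, as all
later entries are successors. Its index `r` among the entries counts the symbols of `τ` other than
`pass`. -/
theorem exists_isEntry_enumerateAfter (τ : List Hat) {O : ℕ → Set (ℕ → Hat)}
    (hO : ∀ N, IsOpen (O N)) (x : ℕ → Hat) :
    ∃ r, IsEntry (enumerateAfter τ O x) r 0 ∧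
      (∀ i > r, ¬ IsEntry (enumerateAfter τ O x) i 0) ∧
      ∀ N, (∃ i > r, IsEntry (enumerateAfter τ O x) i (N + 1)) ↔ x ∈ O N := by
  set Z := enumerateAfter τ O x with hZ
  have h0 : Z τ.length = .num 0 := by simp [hZ, enumerateAfter]
  have hlater : ∀ i, Nat.count (fun j => (Z j).isNum = true) τ.length < i → ∀ a, IsEntry Z i a →
      ∃ N, a = N + 1 ∧ x ∈ O N := by
    rintro i hi a ⟨k, hk, rfl⟩
    have hlt : τ.length < k := lt_of_not_ge fun h => absurd (Nat.count_monotone _ h) (not_le.2 hi)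
    rw [hZ, enumerateAfter, dif_neg (by omega), if_neg (by omega)] at hk
    split_ifs at hk with hc
    exact ⟨_, (Hat.num.inj hk).symm, hc (PiNat.self_mem_cylinder _ _)⟩
  refine ⟨_, isEntry_count h0, fun i hi h => ?_, fun N => ⟨?_, fun hx => ?_⟩⟩
  · obtain ⟨N, hN, -⟩ := hlater i hi 0 h
    omega
  · rintro ⟨i, hi, h⟩
    obtain ⟨M, hM, hx⟩ := hlater i hi _ h
    obtain rfl : N = M := by omega
    exact hx
  · obtain ⟨m, hm⟩ := exists_cylinder_subset (hO N) hx
    have hk : Z (τ.length + 1 + Nat.pair N m) = .num (N + 1) := by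
      rw [hZ, enumerateAfter, dif_neg (by omega), if_neg (by omega)]
      simp [hm]
    refine ⟨_, ?_, isEntry_count hk⟩
    exact Nat.count_strict_mono (p := fun j => (Z j).isNum = true) (by simp [h0, Hat.isNum])
      (by omega)

/-- Gives universality with `τ = []`, and initializability with `G` the universal function itself.
-/
theorem exists_sameP_universalFun {ξ : Ordinal.{0}} {P : ℕ → (ℕ → Prop) → Prop}
    (hP : DescribesDelta0 ξ P) {G : (ℕ → Hat) → ℕ → Hat} (hG : Sigma0Measurable ξ G)
    (τ : List Hat) : ∃ θ : (ℕ → Hat) → ℕ → Hat, Continuous θ ∧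
      (∀ (X : ℕ → Hat) (i : ℕ) (hi : i < τ.length), θ X i = τ[i]) ∧
      ∀ X, SameP (G X) (universalFun P (θ X)) := by
  obtain ⟨O, hO, hGO⟩ := hP.exists_isEntry_iff hG
  refine ⟨enumerateAfter τ O, continuous_enumerateAfter τ O, fun X i hi => ?_, fun X => ?_⟩
  · rw [enumerateAfter, dif_pos hi]
  · obtain ⟨r, hr, hr', hrO⟩ := exists_isEntry_enumerateAfter τ hO X
    refine sameP_search fun n a => ?_
    rw [hGO]
    simp only [universalCond, Set.mem_ofPred_eq]
    constructor
    · rintro ⟨k, hk⟩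
      refine ⟨Nat.pair a (Nat.pair r k), ?_⟩
      simp only [Nat.unpair_pair, hrO]
      exact ⟨⟨⟨hr, hr'⟩, hk⟩, trivial⟩
    · rintro ⟨j, ⟨⟨h1, h2⟩, h3⟩, rfl⟩
      -- A guess below `r` is refuted by the `0` at `r`; a guess above `r` finds no `0`.
      obtain h | h | h := lt_trichotomy j.unpair.2.unpair.1 r
      · exact absurd hr (h2 r h)
      · rw [h] at h3
        simp only [hrO] at h3
        exact ⟨_, h3⟩
      · exact absurd h1 (hr' _ h)

theorem one_add_omega0_opow_lt {α : Ordinal.{0}} (hα : α < ω₁) : 1 + ω ^ α < ω₁ :=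
  Ordinal.isPrincipal_add_omega 1 (Ordinal.one_lt_omega0.trans Ordinal.omega0_lt_omega_one)
    (Ordinal.isPrincipal_opow_omega 1 Ordinal.omega0_lt_omega_one hα)

theorem one_lt_one_add_omega0_opow (α : Ordinal.{0}) : 1 < 1 + ω ^ α :=
  lt_add_of_pos_right 1 (Ordinal.opow_pos α Ordinal.omega0_pos)

theorem exists_isUniversalFamily : ∃ U : Ordinal.{0} → (ℕ → Hat) → (ℕ → Hat),
    IsUniversalFamily U := by
  have h : ∀ α : Ordinal.{0}, ∃ V : (ℕ → Hat) → (ℕ → Hat),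
      α < ω₁ → Conciliatory V ∧ Initializable V ∧ Universal (1 + ω ^ α) V := by
    intro α
    by_cases hα : α < ω₁
    · obtain ⟨P, hP⟩ := exists_describesDelta0 (one_lt_one_add_omega0_opow α)
        (one_add_omega0_opow_lt hα)
      have hm := sigma0Measurable_universalFun (one_lt_one_add_omega0_opow α) hP
      refine ⟨universalFun P, fun _ => ⟨conciliatory_universalFun P,
        fun τ => exists_sameP_universalFun hP hm τ, hm, fun G _ hG => ?_⟩⟩
      obtain ⟨θ, hθ, -, h⟩ := exists_sameP_universalFun hP hG []
      exact ⟨θ, hθ, h⟩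
    · exact ⟨id, fun h => absurd h hα⟩
  choose U hU using h
  exact ⟨U, hU⟩

/-! ### Conciliatory extensions of measurable functions -/

/-- The largest open set of sequences with passes that depends only on the entries and whose trace
on the sequences without passes is contained in `O`. -/
def hatExtension (O : Set (ℕ → ℕ)) : Set (ℕ → Hat) :=
  {Z | ∃ (Y : ℕ → ℕ) (k : ℕ), PiNat.cylinder Y k ⊆ O ∧ ∀ i < k, IsEntry Z i (Y i)}

theorem isOpen_hatExtension (O : Set (ℕ → ℕ)) : IsOpen (hatExtension O) := by
  have : hatExtension O = ⋃ (Y : ℕ → ℕ) (k : ℕ) (_ : PiNat.cylinder Y k ⊆ O),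
      ⋂ i ∈ Finset.range k, {Z | IsEntry Z i (Y i)} := by
    ext Z
    simp [hatExtension]
  rw [this]
  exact isOpen_iUnion fun Y => isOpen_iUnion fun k => isOpen_iUnion fun _ =>
    isOpen_biInter_finset fun i _ => isOpen_isEntry _ _

theorem num_mem_hatExtension {O : Set (ℕ → ℕ)} (hO : IsOpen O) (X : ℕ → ℕ) :
    (fun k => Hat.num (X k)) ∈ hatExtension O ↔ X ∈ O := by
  simp only [hatExtension, Set.mem_ofPred_eq, isEntry_num]
  constructor
  · rintro ⟨Y, k, hk, h⟩
    exact hk h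
  · intro hX
    obtain ⟨k, hk⟩ := exists_cylinder_subset hO hX
    exact ⟨X, k, hk, fun _ _ => rfl⟩

/-- `D` is described by open sets; replacing each by its `hatExtension` and searching again gives
conditions on entries alone. They agree with the original ones on sequences without passes.
Elsewhere the search may mix unrelated values, which does no harm. -/
theorem exists_conciliatory_extension {ξ : Ordinal.{0}} (hξ : 1 < ξ) (hξ₁ : ξ < ω₁)
    {D : (ℕ → ℕ) → ℕ → Hat} (hD : Sigma0Measurable ξ D) :
    ∃ G : (ℕ → Hat) → ℕ → Hat, Conciliatory G ∧ Sigma0Measurable ξ G ∧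
      ∀ X, SameP (D X) (G fun k => Hat.num (X k)) := by
  obtain ⟨P, hP⟩ := exists_describesDelta0 hξ hξ₁
  obtain ⟨O, hO, hDO⟩ := hP.exists_isEntry_iff hD
  refine ⟨fun Z => search fun n j => Z ∈ {Z | P j.unpair.2 fun N =>
    Z ∈ hatExtension (O (Nat.pair (Nat.pair n j.unpair.1) N))}, fun Z Z' h => ?_,
    sigma0Measurable_search hξ.le fun n j =>
      (hP _).2 _ (fun N => isOpen_hatExtension _) _, fun X => sameP_search fun n a => ?_⟩
  · have : ∀ O, Z ∈ hatExtension O ↔ Z' ∈ hatExtension O := fun O => by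
      simp only [hatExtension, Set.mem_ofPred_eq, h _ _]
    simp only [Set.mem_ofPred_eq, this]
    exact fun _ _ => Iff.rfl
  · simp only [hDO, Set.mem_ofPred_eq, num_mem_hatExtension (hO _)]
    constructor
    · rintro ⟨k, hk⟩
      -- A witness pairs the value with the index of the condition proving it.
      exact ⟨Nat.pair a k, by simpa using hk, by simp⟩
    · rintro ⟨j, hj, rfl⟩
      exact ⟨_, hj⟩

/-! ### Auxiliary continuity lemmas -/

theorem continuous_nat_find {X : Type*} [TopologicalSpace X] {p : X → ℕ → Prop}
    [∀ x, DecidablePred (p x)] (h : ∀ x, ∃ n, p x n) (hp : ∀ n, IsClopen {x | p x n}) :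
    Continuous fun x => Nat.find (h x) := by
  refine continuous_discrete_rng.2 fun n => ?_
  have : (fun x => Nat.find (h x)) ⁻¹' {n} =
      {x | p x n} ∩ ⋂ m ∈ Finset.range n, {x | p x m}ᶜ := by
    ext x
    simp [Nat.find_eq_iff]
  rw [this]
  exact (hp n).2.inter (isOpen_biInter_finset fun m _ => (hp m).compl.2)

theorem continuous_of_nat_param {X Y : Type*} [TopologicalSpace X] [TopologicalSpace Y]
    {n : X → ℕ} (hn : Continuous n) {f : ℕ → X → Y} (hf : ∀ m, Continuous (f m)) :
    Continuous fun x => f (n x) x :=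
  (continuous_prod_of_discrete_left (f := fun p : ℕ × X => f p.1 p.2).2 hf).comp
    (hn.prodMk continuous_id)

theorem isClopen_cylinder_subset (V : Set (ℕ → ℕ)) (m : ℕ) :
    IsClopen {X | PiNat.cylinder X m ⊆ V} := by
  classical
  have : Continuous fun X : ℕ → ℕ => decide (PiNat.cylinder X m ⊆ V) :=
    continuous_of_cylinder fun X => ⟨m, fun Y hY => by rw [PiNat.mem_cylinder_iff_eq.1 hY]⟩
  convert (isClopen_discrete {true}).preimage this using 1
  ext X
  simp

/-! ### Translations between sequences with and without passes -/

/-- The inverse of `Hat.ofNat`. -/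
def Hat.toNat : Hat → ℕ
  | .pass => 0
  | .num n => n + 1

theorem Hat.ofNat_toNat (a : Hat) : Hat.ofNat a.toNat = a := by cases a <;> rfl

/-- The inverse of `toHat`. -/
def unHat (Z : ℕ → Hat) : ℕ → ℕ := fun k => (Z k).toNat

theorem toHat_unHat (Z : ℕ → Hat) : toHat (unHat Z) = Z := funext fun _ => Hat.ofNat_toNat _

theorem continuous_coordwise {α β : Type*} [TopologicalSpace α] [DiscreteTopology α]
    [TopologicalSpace β] (f : α → β) : Continuous fun (Z : ℕ → α) (k : ℕ) => f (Z k) :=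
  continuous_pi fun k => continuous_of_discreteTopology.comp (continuous_apply k)

theorem continuous_toHat : Continuous toHat := continuous_coordwise _

theorem continuous_unHat : Continuous unHat := continuous_coordwise _

theorem continuous_toNatHat : Continuous toNatHat :=
  (continuous_apply 0).prodMk
    (continuous_toHat.comp (continuous_pi fun k => continuous_apply (k + 1)))

/-- A sequence with prescribed first entry and tail. -/
def consSeq (m : ℕ) (X : ℕ → ℕ) : ℕ → ℕ
  | 0 => m
  | k + 1 => X k

theorem continuous_consSeq {X : Type*} [TopologicalSpace X] {m : X → ℕ} (hm : Continuous m)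
    {f : X → ℕ → ℕ} (hf : Continuous f) : Continuous fun x => consSeq (m x) (f x) :=
  continuous_pi fun
    | 0 => hm
    | k + 1 => (continuous_apply k).comp hf

/-- Doubling a symbol; `pass` stays `pass`. -/
def Hat.double : Hat → Hat
  | .pass => .pass
  | .num n => .num (2 * n)

theorem Hat.half_double (a : Hat) : a.double.half = a := by
  cases a <;> simp [Hat.double, Hat.half]

theorem Hat.not_odd_double (a : Hat) : ¬ Odd a.double.val := by
  cases a <;> simp [Hat.double, Hat.val]

/-! ### Closure of the pointclasses under continuous preimages -/

section Classes

variable {Q : Type*}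

theorem OnPart.comp {Γ : Set ((ℕ → ℕ) → Q)} {P : Set (ℕ → ℕ)} {A : (ℕ → ℕ) → Q}
    (h : OnPart Γ P A) {θ : (ℕ → ℕ) → ℕ → ℕ} (hθ : Continuous θ) :
    OnPart Γ (θ ⁻¹' P) (A ∘ θ) :=
  fun g hg hgP => h (θ ∘ g) (hθ.comp hg) hgP

/-- A case split suffices, without induction: `OnPart` already ranges over all continuous maps into
the part. -/
theorem Term.sigma_comp {T : Term Q} {A : (ℕ → ℕ) → Q} (h : A ∈ T.sigma)
    {θ : (ℕ → ℕ) → ℕ → ℕ} (hθ : Continuous θ) : A ∘ θ ∈ T.sigma := by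
  cases T with
  | const q =>
    rw [Term.sigma, Set.mem_singleton_iff] at h ⊢
    rw [h]
    rfl
  | jump α hα T =>
    rw [Term.sigma] at h ⊢
    obtain ⟨D, B, hD, hB, rfl⟩ := h
    exact ⟨D ∘ θ, B, fun V hV => (hD V hV).preimage hθ, hB, rfl⟩
  | arrow T F =>
    rw [Term.sigma] at h ⊢
    obtain ⟨V, hV, hT, hF⟩ := h
    exact ⟨θ ⁻¹' V, hV.preimage hθ, hT.comp hθ, hF.comp hθ⟩

/-! ### Mind changes -/

/-- `l` is the position of the first odd entry of `X`. -/
def IsFirstOdd (X : ℕ → Hat) (l : ℕ) : Prop := Odd (X l).val ∧ ∀ m < l, ¬ Odd (X m).val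

open Classical in
theorem mindChange_of_isFirstOdd {A : (ℕ → Hat) → Q} {B : ℕ × (ℕ → Hat) → Q} {X : ℕ → Hat}
    {l : ℕ} (h : IsFirstOdd X l) :
    mindChange A B X = B ((X l).val / 2, fun k => X (l + 1 + k)) := by
  have hex : ∃ l, Odd (X l).val := ⟨l, h.1⟩
  have hl : Nat.find hex = l := (Nat.find_eq_iff hex).2 h
  rw [mindChange, dif_pos hex, hl]

theorem mindChange_of_not_odd {A : (ℕ → Hat) → Q} {B : ℕ × (ℕ → Hat) → Q} {X : ℕ → Hat}
    (h : ¬ ∃ l, Odd (X l).val) : mindChange A B X = A fun k => (X k).half :=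
  dif_neg h

theorem exists_isFirstOdd {X : ℕ → Hat} (h : ∃ l, Odd (X l).val) : ∃ l, IsFirstOdd X l := by
  classical
  exact ⟨Nat.find h, Nat.find_spec h, fun m hm => Nat.find_min h hm⟩

theorem Hat.eq_num_of_odd {a : Hat} (h : Odd a.val) : a = .num a.val := by
  cases a with
  | pass => simp [Hat.val] at h
  | num n => rfl

/-- A `pass` has value 0, which is even, so the first odd symbol is an entry; its index among the
entries and what follows it are unaffected by passes. -/
theorem SameP.isFirstOdd {X Y : ℕ → Hat} (h : SameP X Y) {l : ℕ} (hl : IsFirstOdd X l) :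
    ∃ k, IsFirstOdd Y k ∧ (Y k).val = (X l).val ∧
      SameP (fun i => X (l + 1 + i)) (fun i => Y (k + 1 + i)) := by
  have hX := Hat.eq_num_of_odd hl.1
  obtain ⟨k, hk, hkl⟩ := (h _ _).1 (isEntry_count hX)
  have hval : (Y k).val = (X l).val := by rw [hk]; rfl
  refine ⟨k, ⟨hval ▸ hl.1, fun m hm hodd => ?_⟩, hval, fun n a => ?_⟩
  · have hY := Hat.eq_num_of_odd hodd
    obtain ⟨j, hj, hjm⟩ := (h _ _).2 (isEntry_count hY)
    have hlt : Nat.count (fun j => (Y j).isNum = true) m <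
        Nat.count (fun j => (Y j).isNum = true) k :=
      Nat.count_strict_mono (by rw [hY]; rfl) hm
    rw [← hjm, hkl] at hlt
    refine hl.2 j (Nat.lt_of_count_lt_count hlt) ?_
    rw [hj]
    exact hodd
  · rw [isEntry_tail (X := X), isEntry_tail (X := Y), Nat.count_succ, Nat.count_succ, hkl,
      if_pos (by rw [hX]; rfl), if_pos (by rw [hk]; rfl)]
    exact h _ _

theorem isEntry_half {X : ℕ → Hat} {n a : ℕ} :
    IsEntry (fun k => (X k).half) n a ↔ ∃ b, IsEntry X n b ∧ b / 2 = a := by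
  have hnum : ∀ c : Hat, c.half.isNum = c.isNum := fun c => by cases c <;> rfl
  simp only [IsEntry, hnum]
  constructor
  · rintro ⟨k, hk, hn⟩
    cases hX : X k with
    | pass => simp [hX, Hat.half] at hk
    | num b => exact ⟨b, ⟨k, hX, hn⟩, by simpa [hX, Hat.half] using hk⟩
  · rintro ⟨b, ⟨k, hk, hn⟩, rfl⟩
    exact ⟨k, by simp [hk, Hat.half], hn⟩

theorem mindChange_congr {A : (ℕ → Hat) → Q} {B : ℕ × (ℕ → Hat) → Q}
    (hA : ∀ X Y, SameP X Y → A X = A Y) (hB : ∀ i X Y, SameP X Y → B (i, X) = B (i, Y))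
    {X Y : ℕ → Hat} (h : SameP X Y) : mindChange A B X = mindChange A B Y := by
  by_cases hX : ∃ l, Odd (X l).val
  · obtain ⟨l, hl⟩ := exists_isFirstOdd hX
    obtain ⟨k, hk, hv, ht⟩ := h.isFirstOdd hl
    rw [mindChange_of_isFirstOdd hl, mindChange_of_isFirstOdd hk, hv]
    exact hB _ _ _ ht
  · have hY : ¬ ∃ l, Odd (Y l).val := fun hY => by
      obtain ⟨l, hl⟩ := exists_isFirstOdd hY
      obtain ⟨k, hk, -⟩ := h.symm.isFirstOdd hl
      exact hX ⟨k, hk.1⟩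
    rw [mindChange_of_not_odd hX, mindChange_of_not_odd hY]
    exact hA _ _ fun n a => by simp only [isEntry_half, h _ _]

variable {U : Ordinal.{0} → (ℕ → Hat) → (ℕ → Hat)}

/-- Allows reductions that are correct only up to passes, which is all that universality provides.
-/
theorem Term.omega_congr (hU : IsUniversalFamily U) (T : Term Q) :
    ∀ X Y, SameP X Y → T.omega U X = T.omega U Y := by
  induction T with
  | const q => exact fun _ _ _ => rfl
  | jump α hα T ih => exact fun X Y h => ih _ _ ((hU α hα).1 X Y h)
  | arrow T F ihT ihF => exact fun X Y h => mindChange_congr ihT (fun i => ihF i) h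

/-! ### Membership of the functions in their pointclasses -/

open Classical in
theorem mindChange_toHat_mem {A : (ℕ → Hat) → Q} {B : ℕ → (ℕ → Hat) → Q}
    {Γ : Set ((ℕ → ℕ) → Q)} {Δ : ℕ → Set ((ℕ → ℕ) → Q)}
    (hA : ∀ f : (ℕ → ℕ) → ℕ → Hat, Continuous f → A ∘ f ∈ Γ)
    (hB : ∀ i, ∀ f : (ℕ → ℕ) → ℕ → Hat, Continuous f → B i ∘ f ∈ Δ i) :
    ∃ V : Set (ℕ → ℕ), IsOpen V ∧ OnPart Γ Vᶜ (mindChange A (clopenSum B) ∘ toHat) ∧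
      OnPart (sumClass Δ) V (mindChange A (clopenSum B) ∘ toHat) := by
  have hodd : ∀ l, IsClopen {Z : ℕ → Hat | Odd (Z l).val} := fun l =>
    (isClopen_discrete {a : Hat | Odd a.val}).preimage (continuous_apply l)
  refine ⟨{X | ∃ l, Odd (toHat X l).val}, ?_, fun g hg hgV => ?_, fun g hg hgV => ?_⟩
  · convert isOpen_iUnion fun l => ((hodd l).preimage continuous_toHat).2 using 1
    ext X
    simp
  · convert hA (fun X k => (toHat (g X) k).half)
      ((continuous_coordwise Hat.half).comp (continuous_toHat.comp hg)) using 1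
    funext X
    exact mindChange_of_not_odd (hgV X)
  · have hY : Continuous fun X => toHat (g X) := continuous_toHat.comp hg
    set first : (ℕ → ℕ) → ℕ := fun X => Nat.find (hgV X) with hfirst
    have hcont : Continuous first :=
      continuous_nat_find (p := fun X l => Odd (toHat (g X) l).val) hgV
        fun l => (hodd l).preimage hY
    have hval : Continuous fun X => (toHat (g X) (first X)).val / 2 :=
      continuous_of_nat_param hcont (f := fun m X => (toHat (g X) m).val / 2) fun m =>
        (continuous_of_discreteTopology (f := fun a : Hat => a.val / 2)).comp
          ((continuous_apply m).comp hY)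
    refine ⟨fun i => (fun X => (toHat (g X) (first X)).val / 2) ⁻¹' {i},
      fun i => (isClopen_discrete {i}).preimage hval, fun i j hij => ?_, ?_, fun i f hf hfi => ?_⟩
    · exact Set.disjoint_left.2 fun X hi hj => hij (hi.symm.trans hj)
    · ext X
      simp
    · have htail : Continuous fun (X : ℕ → ℕ) (k : ℕ) => toHat (g X) (first X + 1 + k) :=
        continuous_pi fun k => continuous_of_nat_param hcont
          (f := fun m X => toHat (g X) (m + 1 + k)) fun m => (continuous_apply (m + 1 + k)).comp hY
      convert hB i _ (htail.comp hf) using 1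
      funext X
      have := mindChange_of_isFirstOdd (A := A) (B := clopenSum B)
        (X := toHat (g (f X))) (l := first (f X))
        ⟨Nat.find_spec (hgV (f X)), fun m hm => Nat.find_min (hgV (f X)) hm⟩
      simp only [Function.comp_apply, this, clopenSum]
      rw [show (toHat (g (f X)) (first (f X))).val / 2 = i from hfi X]

theorem Term.omega_comp_mem_of_mem {T : Term Q} (h : T.omega U ∘ toHat ∈ T.sigma)
    {f : (ℕ → ℕ) → ℕ → Hat} (hf : Continuous f) : T.omega U ∘ f ∈ T.sigma := by
  convert T.sigma_comp h (continuous_unHat.comp hf) using 1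
  funext X
  simp [toHat_unHat]

theorem Term.omega_toHat_mem (hU : IsUniversalFamily U) (T : Term Q) :
    T.omega U ∘ toHat ∈ T.sigma := by
  induction T with
  | const q => rw [Term.sigma]; rfl
  | jump α hα T ih =>
    rw [Term.sigma]
    refine ⟨unHat ∘ U α ∘ toHat, T.omega U ∘ toHat, fun V hV => ?_, ih, ?_⟩
    · exact ((hU α hα).2.2.1 _ (hV.preimage continuous_unHat)).preimage continuous_toHat
    · funext X
      simp [Term.omega, toHat_unHat]
  | arrow T F ihT ihF =>
    rw [Term.sigma]
    exact mindChange_toHat_mem (fun f hf => Term.omega_comp_mem_of_mem ihT hf)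
      fun i f hf => Term.omega_comp_mem_of_mem (ihF i) hf

theorem clopenSum_toNatHat_mem {B : ℕ → (ℕ → Hat) → Q} {Δ : ℕ → Set ((ℕ → ℕ) → Q)}
    (hB : ∀ i, ∀ f : (ℕ → ℕ) → ℕ → Hat, Continuous f → B i ∘ f ∈ Δ i) :
    clopenSum B ∘ toNatHat ∈ sumClass Δ := by
  refine ⟨fun i => {X | X 0 = i}, fun i => (isClopen_discrete {i}).preimage (continuous_apply 0),
    fun i j hij => Set.disjoint_left.2 fun X hi hj => hij (hi.symm.trans hj), ?_,
    fun i f hf hfi => ?_⟩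
  · ext X
    simp
  · convert hB i _ (continuous_snd.comp (continuous_toNatHat.comp hf)) using 1
    funext X
    simp only [Function.comp_apply, clopenSum]
    rw [show (toNatHat (f X)).1 = i from hfi X]

/-! ### Completeness -/

variable [Preorder Q]

/-- Every function in `Γ` is continuously reducible to `Ω`. -/
def IsHard {Z : Type*} [TopologicalSpace Z] (Γ : Set ((ℕ → ℕ) → Q)) (Ω : Z → Q) : Prop :=
  ∀ A ∈ Γ, ∃ η : (ℕ → ℕ) → Z, Continuous η ∧ ∀ X, A X ≤ Ω (η X)

/-- A function whose restriction to a closed set `P` is in a class reduces on `P` to a hard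
function. -/
theorem IsHard.exists_of_onPart {Γ : Set ((ℕ → ℕ) → Q)} {Ω : (ℕ → Hat) → Q} (h : IsHard Γ Ω)
    {P : Set (ℕ → ℕ)} (hP : IsClosed P) {A : (ℕ → ℕ) → Q} (hA : OnPart Γ P A) :
    ∃ η : (ℕ → ℕ) → ℕ → Hat, Continuous η ∧ ∀ X ∈ P, A X ≤ Ω (η X) := by
  rcases P.eq_empty_or_nonempty with rfl | hne
  · exact ⟨toHat, continuous_toHat, fun X hX => absurd hX (Set.notMem_empty X)⟩
  -- A retraction makes the restriction total without changing it on `P`.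
  · obtain ⟨ρ, hρ, hran, hcont⟩ := PiNat.exists_retraction_of_isClosed hP hne
    obtain ⟨η, hη, hle⟩ := h _ (hA ρ hcont fun X => hran ▸ Set.mem_range_self X)
    exact ⟨η, hη, fun X hX => by simpa [hρ X hX] using hle X⟩

theorem IsHard.clopenSum {Γ : ℕ → Set ((ℕ → ℕ) → Q)} {Ω : ℕ → (ℕ → Hat) → Q}
    (h : ∀ i, IsHard (Γ i) (Ω i)) : IsHard (sumClass Γ) (clopenSum Ω) := by
  rintro A ⟨C, hC, hd, hu, hA⟩
  choose η hη hle using fun i => (h i).exists_of_onPart (hC i).1 (hA i)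
  have hex : ∀ X, ∃ i, X ∈ C i := fun X => Set.mem_iUnion.1 (hu ▸ Set.mem_univ X)
  choose c hc using hex
  have hcont : Continuous c := by
    refine continuous_discrete_rng.2 fun i => ?_
    convert (hC i).2 using 1
    ext X
    refine ⟨fun hX => (show c X = i from hX) ▸ hc X, fun hX => ?_⟩
    by_contra hne
    exact Set.disjoint_left.1 (hd hne) (hc X) hX
  exact ⟨fun X => (c X, η (c X) X), hcont.prodMk (continuous_of_nat_param hcont hη),
    fun X => hle _ X (hc X)⟩

/-- A function whose restriction to an open set `V` is in a class reduces on `V` to a hard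
function, uniformly in terms of the least `n` for which the cylinder of length `n` is inside `V`. -/
theorem IsHard.exists_of_onPart_isOpen {Z : Type*} [TopologicalSpace Z] [Nonempty Z]
    {Γ : Set ((ℕ → ℕ) → Q)} {Ω : Z → Q}
    (h : IsHard Γ Ω) {V : Set (ℕ → ℕ)} {A : (ℕ → ℕ) → Q} (hA : OnPart Γ V A) :
    ∃ ζ : ℕ → (ℕ → ℕ) → Z, (∀ m, Continuous (ζ m)) ∧
      ∀ m X, PiNat.cylinder X m ⊆ V → A X ≤ Ω (ζ m X) := by
  classical
  rcases V.eq_empty_or_nonempty with rfl | ⟨v, hv⟩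
  · refine ⟨fun _ _ => Classical.arbitrary Z, fun _ => continuous_const, fun m X hX => ?_⟩
    exact absurd (hX (PiNat.self_mem_cylinder X m)) (Set.notMem_empty X)
  · have htail : Continuous fun (Y : ℕ → ℕ) (k : ℕ) => Y (k + 1) :=
      continuous_pi fun k => continuous_apply (k + 1)
    -- A continuous map onto `V`: `Y 0` is a claimed length at which the cylinder of the tail lies
    -- inside `V`. False claims are sent to the fixed point `v`.
    set g : (ℕ → ℕ) → ℕ → ℕ := fun Y =>
      if PiNat.cylinder (fun k => Y (k + 1)) (Y 0) ⊆ V then fun k => Y (k + 1) else v with hg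
    have hgc : Continuous g := by
      refine continuous_of_nat_param (X := ℕ → ℕ) (continuous_apply 0) (f := fun m Y =>
        if PiNat.cylinder (fun k => Y (k + 1)) m ⊆ V then fun k => Y (k + 1) else v) fun m => ?_
      refine Continuous.if (fun Y hY => ?_) htail continuous_const
      have := ((isClopen_cylinder_subset V m).preimage htail).frontier_eq
      exact absurd (this ▸ hY : Y ∈ (∅ : Set (ℕ → ℕ))) (Set.notMem_empty Y)
    have hgV : ∀ Y, g Y ∈ V := fun Y => by
      simp only [hg]
      split_ifs with hY
      · exact hY (PiNat.self_mem_cylinder _ _)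
      · exact hv
    obtain ⟨η, hη, hle⟩ := h _ (hA g hgc hgV)
    refine ⟨fun m X => η (consSeq m X),
      fun m => hη.comp (continuous_consSeq continuous_const continuous_id), fun m X hX => ?_⟩
    have : g (consSeq m X) = X := by
      simp only [hg, consSeq]
      exact if_pos hX
    simpa [this] using hle (consSeq m X)

open Classical in
/-- The input for a mind change operation that plays according to `η` as long as the input is not
known to be in `V`, and according to `ζ` afterwards. -/
noncomputable def mindChangeInput (V : Set (ℕ → ℕ)) (η : (ℕ → ℕ) → ℕ → Hat)
    (ζ : ℕ → (ℕ → ℕ) → ℕ × (ℕ → Hat)) (X : ℕ → ℕ) (t : ℕ) : Hat :=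
  -- The search is capped at `t + 1`, so it terminates outside `V` too and `m` depends continuously
  -- on `X`. The outcome `t < m` means that no cylinder of length at most `t` is inside `V`.
  let m := Nat.find (p := fun m => t < m ∨ PiNat.cylinder X m ⊆ V) ⟨t + 1, Or.inl t.lt_succ_self⟩
  if t < m then (η X t).double
  else if t = m then .num (2 * (ζ m X).1 + 1)
  else (ζ m X).2 (t - (m + 1))

theorem continuous_mindChangeInput (V : Set (ℕ → ℕ)) {η : (ℕ → ℕ) → ℕ → Hat} (hη : Continuous η)
    {ζ : ℕ → (ℕ → ℕ) → ℕ × (ℕ → Hat)} (hζ : ∀ m, Continuous (ζ m)) :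
    Continuous (mindChangeInput V η ζ) := by
  classical
  refine continuous_pi fun t => ?_
  refine continuous_of_nat_param (n := fun X => Nat.find
      (p := fun m => t < m ∨ PiNat.cylinder X m ⊆ V) ⟨t + 1, Or.inl t.lt_succ_self⟩)
    (f := fun m X => if t < m then (η X t).double
      else if t = m then .num (2 * (ζ m X).1 + 1) else (ζ m X).2 (t - (m + 1))) ?_ fun m => ?_
  · refine continuous_nat_find _ fun m => ?_
    by_cases htm : t < m
    · simpa [htm] using isClopen_univ
    · simpa [htm] using isClopen_cylinder_subset V m
  · split_ifs
    · exact (continuous_of_discreteTopology (f := Hat.double)).comp ((continuous_apply t).comp hη)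
    · exact (continuous_of_discreteTopology (f := fun i : ℕ => Hat.num (2 * i + 1))).comp
        (continuous_fst.comp (hζ m))
    · exact (continuous_apply _).comp (continuous_snd.comp (hζ m))

theorem mindChangeInput_of_lt {V : Set (ℕ → ℕ)} {η : (ℕ → ℕ) → ℕ → Hat}
    {ζ : ℕ → (ℕ → ℕ) → ℕ × (ℕ → Hat)} {X : ℕ → ℕ} {t : ℕ}
    (h : ∀ m ≤ t, ¬ PiNat.cylinder X m ⊆ V) : mindChangeInput V η ζ X t = (η X t).double := by
  classical
  refine if_pos ((Nat.lt_find_iff _ _).2 fun m hm => ?_)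
  push Not
  exact ⟨hm, h m hm⟩

theorem mindChangeInput_of_le {V : Set (ℕ → ℕ)} {η : (ℕ → ℕ) → ℕ → Hat}
    {ζ : ℕ → (ℕ → ℕ) → ℕ × (ℕ → Hat)} {X : ℕ → ℕ} {n t : ℕ} (hn : PiNat.cylinder X n ⊆ V)
    (h : ∀ m < n, ¬ PiNat.cylinder X m ⊆ V) (hnt : n ≤ t) : mindChangeInput V η ζ X t =
      if t = n then .num (2 * (ζ n X).1 + 1) else (ζ n X).2 (t - (n + 1)) := by
  classical
  have hm : Nat.find (p := fun m => t < m ∨ PiNat.cylinder X m ⊆ V)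
      ⟨t + 1, Or.inl t.lt_succ_self⟩ = n := by
    refine (Nat.find_eq_iff _).2 ⟨Or.inr hn, fun m hm => ?_⟩
    push Not
    exact ⟨by omega, h m hm⟩
  simp only [mindChangeInput, hm, not_lt.2 hnt, if_false]

/-- Off `V` only doubled symbols are played, and halving recovers `η X`. On `V` the first odd symbol
comes at the least `n` whose cylinder is inside `V`, and is followed by the reduction `ζ n`. -/
theorem IsHard.mindChange {Γ Δ : Set ((ℕ → ℕ) → Q)} {Ω : (ℕ → Hat) → Q}
    {Ω' : ℕ × (ℕ → Hat) → Q} (h : IsHard Γ Ω) (h' : IsHard Δ Ω') {A : (ℕ → ℕ) → Q}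
    {V : Set (ℕ → ℕ)} (hV : IsOpen V) (hA : OnPart Γ Vᶜ A) (hA' : OnPart Δ V A) :
    ∃ η : (ℕ → ℕ) → ℕ → Hat, Continuous η ∧ ∀ X, A X ≤ Wadge.mindChange Ω Ω' (η X) := by
  classical
  obtain ⟨η, hη, hle⟩ := h.exists_of_onPart hV.isClosed_compl hA
  have : Nonempty (ℕ × (ℕ → Hat)) := ⟨(0, fun _ => .pass)⟩
  obtain ⟨ζ, hζ, hle'⟩ := h'.exists_of_onPart_isOpen hA'
  refine ⟨mindChangeInput V η ζ, continuous_mindChangeInput V hη hζ, fun X => ?_⟩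
  by_cases hX : X ∈ V
  · have hex := exists_cylinder_subset hV hX
    set n := Nat.find hex with hn
    have hn1 : PiNat.cylinder X n ⊆ V := Nat.find_spec hex
    have hn2 : ∀ m < n, ¬ PiNat.cylinder X m ⊆ V := fun m hm => Nat.find_min hex hm
    have hval : mindChangeInput V η ζ X n = .num (2 * (ζ n X).1 + 1) := by
      rw [mindChangeInput_of_le hn1 hn2 le_rfl, if_pos rfl]
    have hfirst : IsFirstOdd (mindChangeInput V η ζ X) n := by
      refine ⟨?_, fun m hm => ?_⟩
      · rw [hval]
        exact ⟨_, rfl⟩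
      · rw [mindChangeInput_of_lt fun k hk => hn2 k (by omega)]
        exact Hat.not_odd_double _
    rw [mindChange_of_isFirstOdd hfirst, hval]
    convert hle' n X hn1 using 2
    refine Prod.ext ?_ (funext fun k => ?_)
    · simp only [Hat.val]
      omega
    · change mindChangeInput V η ζ X (n + 1 + k) = _
      rw [mindChangeInput_of_le hn1 hn2 (by omega), if_neg (by omega), Nat.add_sub_cancel_left]
  · have hdouble : mindChangeInput V η ζ X = fun t => (η X t).double := funext fun t =>
      mindChangeInput_of_lt fun m _ hm => hX (hm (PiNat.self_mem_cylinder X m))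
    rw [hdouble, mindChange_of_not_odd (by rintro ⟨l, hl⟩; exact Hat.not_odd_double _ hl)]
    simpa [Hat.half_double] using hle X hX

theorem Term.isHard (hU : IsUniversalFamily U) (T : Term Q) : IsHard T.sigma (T.omega U) := by
  induction T with
  | const q =>
    intro A hA
    rw [Term.sigma, Set.mem_singleton_iff] at hA
    subst hA
    exact ⟨toHat, continuous_toHat, fun X => le_rfl⟩
  | jump α hα T ih =>
    intro A hA
    rw [Term.sigma] at hA
    obtain ⟨D, B, hD, hB, rfl⟩ := hA
    obtain ⟨η, hη, hle⟩ := ih B hB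
    obtain ⟨G, hG, hGm, hDG⟩ := exists_conciliatory_extension (one_lt_one_add_omega0_opow α)
      (one_add_omega0_opow_lt hα) (D := η ∘ D) fun V hV => hD _ (hV.preimage hη)
    obtain ⟨θ, hθ, hGθ⟩ := (hU α hα).2.2.2 G hG hGm
    refine ⟨fun X => θ fun k => Hat.num (X k), hθ.comp (continuous_coordwise _), fun X => ?_⟩
    -- Both the extension `G` and its factorization preserve `η (D X)` up to passes, hence preserve
    -- the value of `Ω_T`.
    have := T.omega_congr hU _ _ ((hDG X).trans (hGθ _))
    simp only [Term.omega, Function.comp_apply] at this ⊢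
    exact this ▸ hle (D X)
  | arrow T F ihT ihF =>
    intro A hA
    rw [Term.sigma] at hA
    obtain ⟨V, hV, hT, hF⟩ := hA
    exact ihT.mindChange (.clopenSum ihF) hV hT hF

end Classes

theorem Forest.isComplete {Q : Type*} [Preorder Q] {U : Ordinal.{0} → (ℕ → Hat) → (ℕ → Hat)}
    (hU : IsUniversalFamily U) (S : Forest Q) : IsComplete S.sigma (S.omega U) := by
  cases S with
  | tree T =>
    refine ⟨T.omega_toHat_mem hU, fun B hB => ?_⟩
    obtain ⟨η, hη, hle⟩ := T.isHard hU B hB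
    exact ⟨unHat ∘ η, continuous_unHat.comp hη, fun X => by
      simpa [Forest.omega, toHat_unHat] using hle X⟩
  | sqcup F =>
    refine ⟨clopenSum_toNatHat_mem fun i f hf =>
      Term.omega_comp_mem_of_mem ((F i).omega_toHat_mem hU) hf, fun B hB => ?_⟩
    obtain ⟨η, hη, hle⟩ := IsHard.clopenSum (fun i => (F i).isHard hU) B hB
    refine ⟨fun X => consSeq (η X).1 (unHat (η X).2), continuous_consSeq (continuous_fst.comp hη)
      (continuous_unHat.comp (continuous_snd.comp hη)), fun X => ?_⟩
    have : toNatHat (consSeq (η X).1 (unHat (η X).2)) = η X :=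
      Prod.ext rfl (toHat_unHat _)
    simpa [Forest.omega, this] using hle X

end Wadge

theorem proposition1p6 {Q : Type*} [Preorder Q] :
    (∃ U : Ordinal.{0} → (ℕ → Wadge.Hat) → (ℕ → Wadge.Hat), Wadge.IsUniversalFamily U) ∧
    ∀ U : Ordinal.{0} → (ℕ → Wadge.Hat) → (ℕ → Wadge.Hat), Wadge.IsUniversalFamily U →
      ∀ ξ : Ordinal.{0}, ξ < ω₁ → ∀ T ∈ Wadge.forestXi Q ξ,
        Wadge.IsComplete T.sigma (T.omega U) :=
  ⟨Wadge.exists_isUniversalFamily, fun _ hU _ _ T _ => T.isComplete hU⟩
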